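/- Let $M\subset\mathbb{CP}^{n-1}$ be a projectively embedded coadjoint orbit, i.e. a connected projective variety (Zariski closed subset of $\mathbb{CP}^{n-1}$) of the form $M=G\cdot x\cong G/K$ for some closed subgroup $G\subset U(n)$ and some point $x\in\mathbb{CP}^{n-1}$, and let $d=\dim_{\mathbb C}M$. Let $I(M)\subset\mathbb C[z_1,\dots,z_n]$ be the homogeneous vanishing ideal of $M$. Let $H^2_n$ be the Drury--Arveson space (the completion of $\mathbb C[z_1,\dots,z_n]$ for the inner product in which the monomials $z^a$ are orthogonal with $\|z^a\|^2=a!/|a|!$), let $\mathfrak H_{\mathbb N}=H^2_n\ominus \overline{I(M)}$ be the associated graded quotient module, with orthogonal projection $P:H^2_n\to\mathfrak H_{\mathbb N}$, and let $S=(S_1,\dots,S_n)$, $S_\alpha=P M_{z_\alpha}|_{\mathfrak H_{\mathbb N}}$, be the compression of the shift (multiplication by the coordinate functions). Then $S$ is a $(d+1)$-isometry: the bounded operators $S_1,\dots,S_n$ commute, and $$(\mathrm{id}-\Phi_*)^{d+1}(\mathbf 1)=0,\qquad\text{where } \Phi_*(X):=\sum_{\alpha=1}^n S_\alpha^*XS_\alpha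 ,\quad X\in B(\mathfrak H_{\mathbb N}).$$ -/

import Mathlib

open scoped LinearAlgebra.Projectivization

noncomputable section

/-! ### Commuting tuples of operators and `q`-isometries -/

/-- The completely positive map `Φ_*(X) = ∑_α S_α^* X S_α` of an operator tuple `S`. -/
def tuplePhi {n : ℕ} {H : Type*} [NormedAddCommGroup H] [InnerProductSpace ℂ H] [CompleteSpace H]
    (S : Fin n → H →L[ℂ] H) (X : H →L[ℂ] H) : H →L[ℂ] H :=
  ∑ α, (ContinuousLinearMap.adjoint (S α)) ∘L X ∘L S α

/-- The defect operators `B_p(S) = (id - Φ_*)^p (1)`. -/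
def tupleDefect {n : ℕ} {H : Type*} [NormedAddCommGroup H] [InnerProductSpace ℂ H]
    [CompleteSpace H] (S : Fin n → H →L[ℂ] H) (p : ℕ) : H →L[ℂ] H :=
  (fun X => X - tuplePhi S X)^[p] (ContinuousLinearMap.id ℂ H)

/-- A tuple of bounded operators is a `q`-isometry if its members commute and `B_q(S) = 0`. -/
def IsQIsometry {n : ℕ} {H : Type*} [NormedAddCommGroup H] [InnerProductSpace ℂ H]
    [CompleteSpace H] (q : ℕ) (S : Fin n → H →L[ℂ] H) : Prop :=
  (∀ α β, S α ∘L S β = S β ∘L S α) ∧ tupleDefect S q = 0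

/-! ### The Drury–Arveson space and its shift -/

/-- The Drury–Arveson space `H²_n` (the symmetric Fock space over `ℂⁿ`): power series
`∑_a c_a z^a` with `∑_a (a! / |a|!) |c_a|² < ∞`, where `a! = ∏_i a_i!` and `|a| = ∑_i a_i`.
It is the Hilbert space of holomorphic functions on the unit ball with reproducing kernel
`1 / (1 - ⟨z, w⟩)`. An element is recorded through its coordinates in the orthonormal basis
`√(|a|! / a!) z^a`, so its `a`-th entry is `√(a! / |a|!) c_a`. -/
abbrev DruryArveson (n : ℕ) : Type :=
  lp (fun _ : Fin n →₀ ℕ => ℂ) 2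

/-- The squared norm `a! / |a|!` of the monomial `z^a` in the Drury–Arveson space. -/
def monomialNormSq {n : ℕ} (a : Fin n →₀ ℕ) : ℝ :=
  ((∏ i, (a i).factorial : ℕ) : ℝ) / ((a.degree).factorial : ℝ)

/-- The inclusion of the polynomials in the Drury–Arveson space, determined by sending `z^a` to
`√(a! / |a|!)` times the `a`-th vector of the orthonormal basis. -/
def polyToDruryArveson (n : ℕ) : MvPolynomial (Fin n) ℂ →ₗ[ℂ] DruryArveson n :=
  (MvPolynomial.basisMonomials (Fin n) ℂ).constr ℂ
    (fun a => lp.single 2 a ((Real.sqrt (monomialNormSq a) : ℝ) : ℂ))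

/-- Multiplication by `z_α` in the coordinates of the orthonormal basis. The coefficient vanishes
if `b_α = 0`, and otherwise `b - single α 1` is a true difference. -/
def shiftFun {n : ℕ} (α : Fin n) (f : (Fin n →₀ ℕ) → ℂ) (b : Fin n →₀ ℕ) : ℂ :=
  ((Real.sqrt ((b α : ℝ) / (b.degree : ℝ)) : ℝ) : ℂ) * f (b - Finsupp.single α 1)

theorem shiftFun_norm_sum_le {n : ℕ} (α : Fin n) (f : DruryArveson n)
    (s : Finset (Fin n →₀ ℕ)) :
    ∑ b ∈ s, ‖shiftFun α f b‖ ^ (2 : ENNReal).toReal ≤ ‖f‖ ^ (2 : ENNReal).toReal := by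
  have h2 : 0 < (2 : ENNReal).toReal := by norm_num
  have hne : (2 : ENNReal).toReal ≠ 0 := h2.ne'
  have hzero : ∀ b : Fin n →₀ ℕ, b α = 0 → shiftFun α f b = 0 := by
    intro b hb
    simp [shiftFun, hb]
  have hle : ∀ b : Fin n →₀ ℕ, ‖shiftFun α f b‖ ≤ ‖f (b - Finsupp.single α 1)‖ := by
    intro b
    have hdeg : b α ≤ b.degree := Finsupp.le_degree α b
    have h1 : (b α : ℝ) / (b.degree : ℝ) ≤ 1 :=
      div_le_one_of_le₀ (by exact_mod_cast hdeg) (Nat.cast_nonneg _)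
    have h3 : Real.sqrt ((b α : ℝ) / (b.degree : ℝ)) ≤ 1 := Real.sqrt_le_one.mpr h1
    rw [shiftFun, norm_mul, Complex.norm_real, Real.norm_of_nonneg (Real.sqrt_nonneg _)]
    exact mul_le_of_le_one_left (norm_nonneg _) h3
  classical
  calc ∑ b ∈ s, ‖shiftFun α f b‖ ^ (2 : ENNReal).toReal
      = ∑ b ∈ s with b α ≠ 0, ‖shiftFun α f b‖ ^ (2 : ENNReal).toReal := by
        symm
        apply Finset.sum_subset (Finset.filter_subset _ _)
        intro b hb hb'
        have hb0 : b α = 0 := by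
          by_contra h
          exact hb' (Finset.mem_filter.mpr ⟨hb, h⟩)
        rw [hzero b hb0, norm_zero, Real.zero_rpow hne]
    _ ≤ ∑ b ∈ s with b α ≠ 0, ‖f (b - Finsupp.single α 1)‖ ^ (2 : ENNReal).toReal :=
        Finset.sum_le_sum fun b _ => Real.rpow_le_rpow (norm_nonneg _) (hle b) h2.le
    _ = ∑ a ∈ ({b ∈ s | b α ≠ 0}).image (fun b => b - Finsupp.single α 1),
          ‖f a‖ ^ (2 : ENNReal).toReal := by
        rw [Finset.sum_image]
        intro b hb c hc hbc
        have hb1 : Finsupp.single α 1 ≤ b := by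
          rw [Finsupp.single_le_iff]
          exact Nat.one_le_iff_ne_zero.mpr (Finset.mem_filter.mp hb).2
        have hc1 : Finsupp.single α 1 ≤ c := by
          rw [Finsupp.single_le_iff]
          exact Nat.one_le_iff_ne_zero.mpr (Finset.mem_filter.mp hc).2
        have := congrArg (fun x => x + Finsupp.single α 1) hbc
        simpa [tsub_add_cancel_of_le hb1, tsub_add_cancel_of_le hc1] using this
    _ ≤ ‖f‖ ^ (2 : ENNReal).toReal := lp.sum_rpow_le_norm_rpow h2 f _

/-- The operator of multiplication by the coordinate function `z_α` on `H²_n`. -/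
def druryArvesonShift {n : ℕ} (α : Fin n) : DruryArveson n →L[ℂ] DruryArveson n :=
  LinearMap.mkContinuous
    { toFun := fun f => ⟨shiftFun α f, memℓp_gen' (shiftFun_norm_sum_le α f)⟩
      map_add' := fun f g => by
        ext b
        simp only [shiftFun, lp.coeFn_add, Pi.add_apply]
        ring
      map_smul' := fun c f => by
        ext b
        simp only [shiftFun, lp.coeFn_smul, Pi.smul_apply, smul_eq_mul, RingHom.id_apply]
        ring }
    1
    (fun f => by
      rw [one_mul]
      exact lp.norm_le_of_forall_sum_le (by norm_num) (norm_nonneg _)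
        (fun s => shiftFun_norm_sum_le α f s))

/-! ### Projective varieties and their graded quotient modules -/

/-- The quotient topology of complex projective space. -/
instance projectivizationTopology (n : ℕ) : TopologicalSpace (ℙ ℂ (Fin n → ℂ)) :=
  inferInstanceAs (TopologicalSpace (Quotient (projectivizationSetoid ℂ (Fin n → ℂ))))

/-- The punctured affine cone over a subset of `ℂℙ^{n-1}`. -/
def puncturedCone {n : ℕ} (M : Set (ℙ ℂ (Fin n → ℂ))) : Set (Fin n → ℂ) :=
  {z | ∃ hz : z ≠ 0, Projectivization.mk ℂ z hz ∈ M}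

/-- The (homogeneous) vanishing ideal of a non-empty subset `M` of `ℂℙ^{n-1}`. -/
def homogeneousIdeal {n : ℕ} (M : Set (ℙ ℂ (Fin n → ℂ))) : Ideal (MvPolynomial (Fin n) ℂ) :=
  MvPolynomial.vanishingIdeal ℂ (puncturedCone M)

/-- The homogeneous coordinate ring `𝒜 = ℂ[z_1, …, z_n] / I(M)`. -/
abbrev CoordinateRing {n : ℕ} (M : Set (ℙ ℂ (Fin n → ℂ))) : Type :=
  MvPolynomial (Fin n) ℂ ⧸ homogeneousIdeal M

/-- The projective variety `M` has complex dimension `d`: its affine cone, that is, its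
homogeneous coordinate ring, has dimension `d + 1`. -/
def HasComplexDim {n : ℕ} (M : Set (ℙ ℂ (Fin n → ℂ))) (d : ℕ) : Prop :=
  ringKrullDim (CoordinateRing M) = ((d + 1 : ℕ) : WithBot ℕ∞)

/-- `M ⊆ ℂℙ^{n-1}` is Zariski closed: every point at which all elements of `I(M)` vanish lies
in `M`. -/
def IsProjectiveVariety {n : ℕ} (M : Set (ℙ ℂ (Fin n → ℂ))) : Prop :=
  ∀ (z : Fin n → ℂ) (hz : z ≠ 0),
    z ∈ MvPolynomial.zeroLocus ℂ (homogeneousIdeal M) → Projectivization.mk ℂ z hz ∈ M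

/-- The orbit `G · x` of a point `x = [v]` of `ℂℙ^{n-1}` under a group `G` of unitary matrices. -/
def projectiveOrbit {n : ℕ} (G : Subgroup (Matrix.unitaryGroup (Fin n) ℂ))
    (x : ℙ ℂ (Fin n → ℂ)) : Set (ℙ ℂ (Fin n → ℂ)) :=
  {y | ∃ g ∈ G, ∃ (v w : Fin n → ℂ) (hv : v ≠ 0) (hw : w ≠ 0),
    w = (g : Matrix (Fin n) (Fin n) ℂ).mulVec v ∧
      x = Projectivization.mk ℂ v hv ∧ y = Projectivization.mk ℂ w hw}

/-- `M ⊆ ℂℙ^{n-1}` is a (projectively embedded) coadjoint orbit: a connected projective variety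
`M = G/K` which is one orbit of a compact matrix group `G ⊆ U(n)`. Since `G` is a group of
isometries of the Fubini–Study metric, `M` is then a homogeneous compact Kähler manifold, which
the moment map `[v] ↦ (X ↦ -i ⟨v, X v⟩ / ⟨v, v⟩)` identifies with a coadjoint orbit of (the
identity component of) the compact Lie group `G`; and every equivariant projective embedding of a coadjoint orbit (with its
invariant complex structure) has this form. -/
structure IsCoadjointOrbit {n : ℕ} (M : Set (ℙ ℂ (Fin n → ℂ))) : Prop where
  homogeneous : ∃ G : Subgroup (Matrix.unitaryGroup (Fin n) ℂ),
    IsClosed (G : Set (Matrix.unitaryGroup (Fin n) ℂ)) ∧ ∃ x, M = projectiveOrbit G x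
  connected : IsConnected M
  variety : IsProjectiveVariety M

/-- The graded quotient module `H_ℕ = H²_n ⊖ [I(M)]`, the orthogonal complement in the
Drury–Arveson space of the ideal of `M`: the completion of the homogeneous coordinate ring in the
inner product of the symmetric Fock space. -/
def quotientModule {n : ℕ} (M : Set (ℙ ℂ (Fin n → ℂ))) : Submodule ℂ (DruryArveson n) :=
  (((homogeneousIdeal M).restrictScalars ℂ).map (polyToDruryArveson n))ᗮ

instance quotientModule_completeSpace {n : ℕ} (M : Set (ℙ ℂ (Fin n → ℂ))) :
    CompleteSpace (quotientModule M) :=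
  inferInstanceAs
    (CompleteSpace ((((homogeneousIdeal M).restrictScalars ℂ).map (polyToDruryArveson n))ᗮ))

/-- The compression `S_α = P z_α |` of the shift of `H²_n` to the quotient module. -/
def compressedShift {n : ℕ} (M : Set (ℙ ℂ (Fin n → ℂ))) (α : Fin n) :
    quotientModule M →L[ℂ] quotientModule M :=
  (quotientModule M).orthogonalProjectionOnto ∘L druryArvesonShift α ∘L (quotientModule M).subtypeL

end

/-! ### Hilbert functions of homogeneous ideals -/

namespace Polynomial

/-! Let `K` be the compact group `Circle × G`, `μ` its Haar probability measure, `v` a unit vector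
on the cone over `M`, and `u x = ρ x v`. The averaged kernel `∫ ⟨u, w⟩^k ⟨z, u⟩^k dμ` is a
polynomial in `z` and `star w`. By invariance of `μ` it equals `c k * ‖z‖^(2k)` on the diagonal of
the affine cone. The cone is irreducible, so this polarizes to `c k * ⟨z, w⟩^k` for all pairs of its
points (`integral_kernel_eq`).

The degree `k` part of the quotient module is spanned by the kernels `⟨·, w⟩^k` with `w` on the
cone. Hence on it the inner product of `L²(μ)` is `c k` times the Drury–Arveson one. Since `∑ |u_α|²
= 1`, multiplication by the coordinates is a row of operators preserving `L²` norms, and `∑ S_α^*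
S_α` acts in degree `k` as the scalar `c k / c (k + 1)` (`sum_adjoint_compressedShift`). The `q`-th
defect operator is then `c k` times the `q`-th difference of `1 / c` at `k`. Integrating the
reproducing kernel over the diagonal identifies `1 / c k` with the Hilbert function of `M`
(`mul_finrank_kernelSpan_eq_one`).

It remains to see that the Hilbert function is, for every `k` and not only for large `k`, a
polynomial of degree at most `d`; its differences of order `d + 1` then vanish. Large `k` is
Hilbert's theorem, with the degree bounded by Noether normalization. For small `k`, the `c k` are
moments of `t = |⟨u, v⟩|²`, where `0 < t ≤ 1` almost everywhere, and reciprocals of such moments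
that are eventually polynomial are polynomial from the start (`eval_mul_integral_pow_eq_one`).

Two geometric facts support this: connectedness and homogeneity make the ideal of `M` prime
(`isPrime_homogeneousIdeal`), and a polynomial outside that ideal vanishes only on a null subset of
the orbit (`ae_eval_mulVec_ne_zero`). -/

theorem exists_comp_add_one_sub_eq (R : ℚ[X]) :
    ∃ S : ℚ[X], ∀ x : ℚ, S.eval (x + 1) - S.eval x = R.eval x := by
  induction R using Polynomial.induction_on' with
  | add p q hp hq =>
    obtain ⟨S, hS⟩ := hp
    obtain ⟨T, hT⟩ := hq
    refine ⟨S + T, fun x => ?_⟩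
    rw [eval_add, eval_add, eval_add, ← hS, ← hT]
    ring
  | monomial m a =>
    -- Bernoulli polynomials satisfy `B_{m+1}(x + 1) - B_{m+1}(x) = (m + 1) x^m`.
    refine ⟨C (a / (m + 1)) * Polynomial.bernoulli (m + 1), fun x => ?_⟩
    have h := Polynomial.bernoulli_eval_one_add (m + 1) x
    have h0 : (m + 1 : ℚ) ≠ 0 := by positivity
    rw [eval_mul, eval_mul, eval_C, add_comm x 1, h, eval_monomial]
    push_cast
    rw [eval_C]
    field_simp
    ring

/-- A function whose forward difference is eventually polynomial is eventually polynomial. -/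
theorem exists_eventually_eq_of_sub (u : ℕ → ℚ) (R : ℚ[X]) (k₀ : ℕ)
    (h : ∀ k ≥ k₀, u (k + 1) - u k = R.eval (k : ℚ)) :
    ∃ S : ℚ[X], ∀ k ≥ k₀, u k = S.eval (k : ℚ) := by
  obtain ⟨S, hS⟩ := exists_comp_add_one_sub_eq R
  refine ⟨S + C (u k₀ - S.eval (k₀ : ℚ)), fun k hk => ?_⟩
  induction k, hk using Nat.le_induction with
  | base => simp
  | succ k hk ih =>
    have h1 := h k hk
    have h2 := hS k
    rw [eval_add, eval_C] at ih ⊢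
    push_cast
    linarith

end Polynomial

namespace MvPolynomial

variable {σ F : Type*} [Field F]

theorem homogeneousComponent_X_mul (i : σ) (k : ℕ) (f : MvPolynomial σ F) :
    homogeneousComponent (k + 1) (X i * f) = X i * homogeneousComponent k f := by
  induction f using MvPolynomial.induction_on' with
  | monomial a c =>
    have h1 : (X i * monomial a c : MvPolynomial σ F) ∈ homogeneousSubmodule σ F (1 + a.degree) :=
      (isHomogeneous_X F i).mul (isHomogeneous_monomial c rfl)
    rw [homogeneousComponent_of_mem h1, homogeneousComponent_of_mem (isHomogeneous_monomial c rfl)]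
    by_cases h : k = a.degree
    · subst h
      simp [add_comm]
    · rw [if_neg h, if_neg (by omega), mul_zero]
  | add p q hp hq => rw [mul_add, map_add, hp, hq, map_add, mul_add]

/-- An ideal that contains the homogeneous components of its members. -/
def ContainsComponents (J : Ideal (MvPolynomial σ F)) : Prop :=
  ∀ f ∈ J, ∀ k, homogeneousComponent k f ∈ J

/-- The degree `k` part of an ideal. -/
noncomputable def gradedPiece (J : Ideal (MvPolynomial σ F)) (k : ℕ) :
    Submodule F (MvPolynomial σ F) :=
  J.restrictScalars F ⊓ homogeneousSubmodule σ F k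

theorem mem_gradedPiece {J : Ideal (MvPolynomial σ F)} {k : ℕ} {f : MvPolynomial σ F} :
    f ∈ gradedPiece J k ↔ f ∈ J ∧ f.IsHomogeneous k := Iff.rfl

instance homogeneousSubmodule_finite [Finite σ] (k : ℕ) :
    Module.Finite F (homogeneousSubmodule σ F k) :=
  Module.Finite.iff_fg.mpr (homogeneousSubmodule_fg σ F k)

instance gradedPiece_finite [Finite σ] (J : Ideal (MvPolynomial σ F)) (k : ℕ) :
    Module.Finite F (gradedPiece J k) :=
  Submodule.finiteDimensional_of_le inf_le_right

theorem gradedPiece_mono {J J' : Ideal (MvPolynomial σ F)} (h : J' ≤ J) (k : ℕ) :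
    gradedPiece J' k ≤ gradedPiece J k :=
  inf_le_inf_right _ h

/-- If all the variables map `J` to `J'`, then `J` and `J'` agree in large degrees. -/
theorem exists_gradedPiece_eq [Finite σ] {J J' : Ideal (MvPolynomial σ F)} (hJJ : J' ≤ J)
    (hJ' : ContainsComponents J') (hX : ∀ i, ∀ f ∈ J, X i * f ∈ J') :
    ∃ k₀, ∀ k ≥ k₀, gradedPiece J k = gradedPiece J' k := by
  classical
  obtain ⟨S, hS⟩ := (isNoetherianRing_iff_ideal_fg _).mp
    (inferInstance : IsNoetherianRing (MvPolynomial σ F)) J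
  -- Modulo `J'` a polynomial acts on `J` through its constant term. So `J / J'` is spanned over the
  -- field by the finitely many generators, and nothing survives above their degrees.
  have hmul : ∀ p : MvPolynomial σ F, ∀ f ∈ J, p * f - C (constantCoeff p) * f ∈ J' := by
    intro p f hf
    induction p using MvPolynomial.induction_on with
    | C a => simp
    | add p q hp hq =>
      have := J'.add_mem hp hq
      convert this using 1
      simp only [map_add]
      ring
    | mul_X p i _ =>
      have := J'.mul_mem_left p (hX i f hf)
      convert this using 1
      simp only [map_mul, constantCoeff_X, mul_zero, map_zero, zero_mul, sub_zero]
      ring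
  refine ⟨S.sup totalDegree + 1, fun k hk => le_antisymm (fun f hf => ?_) (gradedPiece_mono hJJ k)⟩
  obtain ⟨hfJ, hfk⟩ := mem_gradedPiece.mp hf
  refine mem_gradedPiece.mpr ⟨?_, hfk⟩
  have hspan : ∀ g ∈ J, homogeneousComponent k g ∈ J' := by
    intro g hg
    rw [← hS] at hg
    induction hg using Submodule.span_induction with
    | zero => simp
    | add x y _ _ hx hy => rw [map_add]; exact J'.add_mem hx hy
    | mem x hx =>
      rw [homogeneousComponent_eq_zero]
      · exact J'.zero_mem
      · have : x.totalDegree ≤ S.sup totalDegree := Finset.le_sup (f := totalDegree) hx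
        omega
    | smul p x hx hxk =>
      have hxJ : x ∈ J := hS ▸ hx
      have h1 := hJ' _ (hmul p x hxJ) k
      rw [map_sub, homogeneousComponent_C_mul] at h1
      have h2 := J'.add_mem h1 (J'.mul_mem_left (C (constantCoeff p)) hxk)
      simpa using h2
  have := hspan f hfJ
  rwa [homogeneousComponent_eq_self hfk] at this

/-- Multiplication by a variable computes the growth of the Hilbert function of `J / J'`. -/
theorem finrank_gradedPiece_X_mul [Finite σ] {J J' : Ideal (MvPolynomial σ F)}
    (hJ : ContainsComponents J) (hJ' : ContainsComponents J') (i : σ) (k : ℕ) :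
    (Module.finrank F (gradedPiece J k) : ℚ) -
        Module.finrank F (gradedPiece (J ⊓ J'.colon {X i}) k) =
      Module.finrank F (gradedPiece (Ideal.span {X i} * J ⊔ J') (k + 1)) -
        Module.finrank F (gradedPiece J' (k + 1)) := by
  classical
  set L := gradedPiece (Ideal.span {X i} * J ⊔ J') (k + 1) with hL
  set L' : Submodule F L := (gradedPiece J' (k + 1)).submoduleOf L with hL'
  have hmaps : ∀ f ∈ gradedPiece J k, (LinearMap.mulLeft F (X i)) f ∈ L := by
    intro f hf
    refine mem_gradedPiece.mpr ⟨?_, ?_⟩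
    · exact Ideal.mem_sup_left (Ideal.mul_mem_mul (Ideal.mem_span_singleton_self _) hf.1)
    · rw [add_comm]
      exact (isHomogeneous_X F i).mul hf.2
  -- The claim is rank–nullity for this map, induced by multiplication by `X i`.
  let φ : gradedPiece J k →ₗ[F] L ⧸ L' := L'.mkQ ∘ₗ (LinearMap.mulLeft F (X i)).restrict hmaps
  have hker : (LinearMap.ker φ) = (gradedPiece (J ⊓ J'.colon {X i}) k).submoduleOf
      (gradedPiece J k) := by
    ext ⟨f, hf⟩
    simp only [φ, LinearMap.mem_ker, LinearMap.comp_apply, Submodule.mkQ_apply,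
      Submodule.Quotient.mk_eq_zero, hL', Submodule.submoduleOf, Submodule.mem_comap,
      Submodule.subtype_apply, LinearMap.coe_restrict_apply, LinearMap.mulLeft_apply,
      mem_gradedPiece, Ideal.mem_inf, Submodule.mem_colon_singleton, smul_eq_mul, mul_comm f]
    constructor
    · rintro ⟨h, _⟩
      exact ⟨⟨hf.1, h⟩, hf.2⟩
    · rintro ⟨⟨_, h⟩, _⟩
      exact ⟨h, by rw [add_comm]; exact (isHomogeneous_X F i).mul hf.2⟩
  have hsurj : Function.Surjective φ := by
    intro q
    obtain ⟨⟨g, hg⟩, rfl⟩ := L'.mkQ_surjective q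
    obtain ⟨hgm, hgk⟩ := mem_gradedPiece.mp hg
    obtain ⟨a, ha, b, hb, rfl⟩ := Submodule.mem_sup.mp hgm
    obtain ⟨f, hf, rfl⟩ := Ideal.mem_span_singleton_mul.mp ha
    -- In degree `k + 1`, the element `X i * f + b` reduces to `X i * f_k + b_{k+1}`, so only the
    -- component `f_k` matters.
    refine ⟨⟨homogeneousComponent k f, hJ f hf k, homogeneousComponent_mem k f⟩, ?_⟩
    simp only [φ, LinearMap.comp_apply, Submodule.mkQ_apply]
    rw [Submodule.Quotient.eq]
    simp only [hL', Submodule.submoduleOf, Submodule.mem_comap, Submodule.subtype_apply,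
      AddSubgroupClass.coe_sub, LinearMap.coe_restrict_apply, LinearMap.mulLeft_apply]
    have h1 := homogeneousComponent_eq_self hgk
    rw [map_add, homogeneousComponent_X_mul] at h1
    rw [← h1, sub_add_cancel_left]
    exact Submodule.neg_mem _ ⟨hJ' b hb (k + 1), homogeneousComponent_mem _ _⟩
  have e1 := LinearMap.finrank_range_add_finrank_ker φ
  rw [LinearMap.range_eq_top.mpr hsurj, finrank_top, hker,
    (Submodule.submoduleOfEquivOfLe (gradedPiece_mono inf_le_left k)).finrank_eq] at e1
  have e2 := Submodule.finrank_quotient_add_finrank L'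
  rw [hL', (Submodule.submoduleOfEquivOfLe (gradedPiece_mono le_sup_right (k + 1))).finrank_eq,
    ← hL'] at e2
  rw [← e1, ← e2]
  push_cast
  ring

/-- The Hilbert function of a quotient of homogeneous ideals is eventually polynomial. -/
theorem exists_hilbertPolynomial_aux {n : ℕ} (m : ℕ) (J J' : Ideal (MvPolynomial (Fin n) F))
    (hJJ : J' ≤ J) (hJ : ContainsComponents J) (hJ' : ContainsComponents J')
    (hX : ∀ i : Fin n, m ≤ i → ∀ f ∈ J, X i * f ∈ J') :
    ∃ (Q : Polynomial ℚ) (k₀ : ℕ), ∀ k ≥ k₀, (Module.finrank F (gradedPiece J k) : ℚ) -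
      Module.finrank F (gradedPiece J' k) = Q.eval (k : ℚ) := by
  -- The induction is on the number of variables that may act non-trivially on `J / J'`. The kernel
  -- and the cokernel of multiplication by the last of them are killed by it, so both have
  -- eventually polynomial Hilbert functions, and these determine the difference `h (k + 1) - h k`
  -- for `J / J'`.
  induction m generalizing J J' with
  | zero =>
    obtain ⟨k₀, h⟩ := exists_gradedPiece_eq hJJ hJ' (fun i => hX i (Nat.zero_le _))
    exact ⟨0, k₀, fun k hk => by rw [h k hk]; simp⟩
  | succ m ih =>
    by_cases hm : n ≤ m
    · exact ih J J' hJJ hJ hJ' (fun i hi => absurd i.2 (by omega))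
    · let i : Fin n := ⟨m, by omega⟩
      have hspan : Ideal.span {X i} * J ⊔ J' ≤ J := sup_le Ideal.mul_le_right hJJ
      have hK : J' ≤ J ⊓ J'.colon {X i} := by
        refine le_inf hJJ (fun f hf => ?_)
        rw [Submodule.mem_colon_singleton, smul_eq_mul]
        exact J'.mul_mem_right _ hf
      obtain ⟨Q₁, k₁, h₁⟩ := ih J (Ideal.span {X i} * J ⊔ J') hspan hJ
        (by
          intro f hf k
          obtain ⟨a, ha, b, hb, rfl⟩ := Submodule.mem_sup.mp hf
          obtain ⟨g, hg, rfl⟩ := Ideal.mem_span_singleton_mul.mp ha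
          rw [map_add]
          refine Ideal.add_mem _ ?_ (Ideal.mem_sup_right (hJ' b hb k))
          cases k with
          | zero => simp [homogeneousComponent_zero, coeff_X_mul']
          | succ k =>
            rw [homogeneousComponent_X_mul]
            exact Ideal.mem_sup_left
              (Ideal.mul_mem_mul (Ideal.mem_span_singleton_self _) (hJ g hg k)))
        (by
          intro j hj f hf
          rcases hj.eq_or_lt with h | h
          · have : j = i := Fin.ext h.symm
            subst this
            exact Ideal.mem_sup_left (Ideal.mul_mem_mul (Ideal.mem_span_singleton_self _) hf)
          · exact Ideal.mem_sup_right (hX j h f hf))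
      obtain ⟨Q₂, k₂, h₂⟩ := ih (J ⊓ J'.colon {X i}) J' hK
        (by
          rintro f ⟨hf, hf'⟩ k
          refine ⟨hJ f hf k, ?_⟩
          have h1 : f * X i ∈ J' := by simpa [Submodule.mem_colon_singleton] using hf'
          have h2 := hJ' _ h1 (k + 1)
          rw [mul_comm, homogeneousComponent_X_mul, mul_comm] at h2
          simpa [Submodule.mem_colon_singleton] using h2)
        hJ'
        (by
          rintro j hj f ⟨hf, hf'⟩
          rcases hj.eq_or_lt with h | h
          · have : j = i := Fin.ext h.symm
            subst this
            have h1 : f * X i ∈ J' := by simpa [Submodule.mem_colon_singleton] using hf'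
            rwa [mul_comm] at h1
          · exact hX j h f hf)
      obtain ⟨S, hS⟩ := Polynomial.exists_eventually_eq_of_sub
        (fun k => (Module.finrank F (gradedPiece J k) : ℚ) - Module.finrank F (gradedPiece J' k))
        (Q₁.comp (Polynomial.X + 1) - Q₂) (max k₁ k₂)
        (fun k hk => by
          have e1 := h₁ (k + 1) (by have := le_max_left k₁ k₂; omega)
          have e2 := h₂ k ((le_max_right k₁ k₂).trans hk)
          have e3 := finrank_gradedPiece_X_mul hJ hJ' i k
          simp only [Polynomial.eval_sub, Polynomial.eval_comp, Polynomial.eval_add,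
            Polynomial.eval_X, Polynomial.eval_one]
          push_cast at e1
          rw [← e1, ← e2]
          linarith)
      exact ⟨S, _, hS⟩

theorem exists_hilbertPolynomial {n : ℕ} (I : Ideal (MvPolynomial (Fin n) F))
    (hI : ContainsComponents I) :
    ∃ (Q : Polynomial ℚ) (k₀ : ℕ), ∀ k ≥ k₀,
      (Module.finrank F (homogeneousSubmodule (Fin n) F k) : ℚ) -
        Module.finrank F (gradedPiece I k) = Q.eval (k : ℚ) := by
  obtain ⟨Q, k₀, h⟩ := exists_hilbertPolynomial_aux n ⊤ I le_top (fun _ _ _ => trivial) hI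
    (fun i hi => absurd i.2 (by omega))
  refine ⟨Q, k₀, fun k hk => ?_⟩
  rw [← h k hk]
  have : gradedPiece (⊤ : Ideal (MvPolynomial (Fin n) F)) k = homogeneousSubmodule (Fin n) F k := by
    ext f
    simp [mem_gradedPiece]
  rw [this]

end MvPolynomial

/-! ### Extrapolation of reciprocals of Hausdorff moments -/

section Moments

open MeasureTheory Filter Topology Finset

/-- This follows from `C(j,l) C(l,m) = C(j,m) C(j-m,l-m)` and the binomial theorem. It turns
alternating sums of moments into integrals of Bernstein polynomials. -/
theorem sum_neg_one_pow_choose_mul_choose_mul_pow (j m : ℕ) (t : ℝ) :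
    ∑ l ∈ range (j + 1), (-1) ^ l * (j.choose l : ℝ) * (l.choose m : ℝ) * t ^ l =
      (-1) ^ m * ((j.choose m : ℝ) * t ^ m * (1 - t) ^ (j - m)) := by
  by_cases hm : j < m
  · rw [Nat.choose_eq_zero_of_lt hm]
    simp only [Nat.cast_zero, zero_mul, mul_zero]
    refine sum_eq_zero fun l hl => ?_
    rw [mem_range] at hl
    rw [Nat.choose_eq_zero_of_lt (show l < m by omega)]
    simp
  · obtain ⟨i, rfl⟩ := Nat.exists_eq_add_of_le (not_lt.mp hm)
    rw [show m + i + 1 = m + (i + 1) by ring, sum_range_add, Nat.add_sub_cancel_left]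
    have h0 : ∑ x ∈ range m, (-1) ^ x * ((m + i).choose x : ℝ) * (x.choose m : ℝ) * t ^ x = 0 := by
      refine sum_eq_zero fun l hl => ?_
      rw [mem_range] at hl
      rw [Nat.choose_eq_zero_of_lt hl]
      simp
    rw [h0, zero_add, show (1 - t) = (-t + 1) by ring, add_pow, mul_sum, mul_sum]
    refine sum_congr rfl fun x _ => ?_
    have h1 : (((m + i).choose (m + x) : ℝ)) * ((m + x).choose m : ℝ) =
        ((m + i).choose m : ℝ) * (i.choose x : ℝ) := by
      have := Nat.choose_mul (n := m + i) (k := m + x) (s := m) (by omega)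
      rw [Nat.add_sub_cancel_left, Nat.add_sub_cancel_left] at this
      exact_mod_cast this
    rw [mul_assoc ((-1 : ℝ) ^ (m + x)), h1, neg_pow t, one_pow, pow_add, pow_add]
    ring

/-- A single non-negative term of the expansion of `(t + (1 - t))^j`. -/
theorem choose_mul_pow_mul_pow_le_one (j m : ℕ) {t : ℝ} (h0 : 0 ≤ t) (h1 : t ≤ 1) :
    (j.choose m : ℝ) * t ^ m * (1 - t) ^ (j - m) ≤ 1 := by
  have h1' : 0 ≤ 1 - t := by linarith
  by_cases hm : j < m
  · simp [Nat.choose_eq_zero_of_lt hm]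
  · have h : (t + (1 - t)) ^ j = 1 := by simp
    rw [add_pow] at h
    refine le_of_le_of_eq (le_trans (le_of_eq ?_) (single_le_sum
      (f := fun m => t ^ m * (1 - t) ^ (j - m) * (j.choose m : ℝ))
      (fun i _ => by positivity) (mem_range.mpr (by omega : m < j + 1)))) h
    ring

/-- For fixed `m`, polynomial growth in `j` loses against geometric decay. Positivity of `t` is
essential: at `t = 0`, `m = 0` the expression is constantly `1`. -/
theorem tendsto_choose_mul_pow_mul_pow (m : ℕ) {t : ℝ} (h0 : 0 < t) (h1 : t ≤ 1) :
    Tendsto (fun j : ℕ => (j.choose m : ℝ) * t ^ m * (1 - t) ^ (j - m)) atTop (𝓝 0) := by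
  rw [← tendsto_add_atTop_iff_nat m]
  have h := (summable_choose_mul_geometric_of_norm_lt_one m (r := 1 - t)
    (by rw [Real.norm_eq_abs, abs_lt]; constructor <;> linarith)).tendsto_atTop_zero.mul_const
      (t ^ m)
  rw [zero_mul] at h
  refine h.congr fun i => ?_
  rw [Nat.add_sub_cancel]
  ring

/-- Newton's forward difference formula, cut off at the degree so that the range of summation does
not depend on `l` and sums can be interchanged. -/
theorem Polynomial.eval_add_natCast_eq_sum_choose (Q : Polynomial ℝ) (k l : ℕ) :
    Q.eval ((k + l : ℕ) : ℝ) = ∑ m ∈ range (Q.natDegree + 1),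
      (l.choose m : ℝ) * ((fwdDiff (1 : ℝ))^[m] Q.eval k) := by
  have h := shift_eq_sum_fwdDiff_iter (1 : ℝ) Q.eval l (k : ℝ)
  simp only [nsmul_eq_mul, mul_one] at h
  push_cast
  rw [h]
  rcases le_total l Q.natDegree with hl | hl
  · refine sum_subset (range_mono (by omega)) fun m _ hm => ?_
    rw [mem_range, not_lt] at hm
    rw [Nat.choose_eq_zero_of_lt (by omega)]
    simp
  · symm
    refine sum_subset (range_mono (by omega)) fun m _ hm => ?_
    rw [mem_range, not_lt] at hm
    rw [Polynomial.fwdDiff_iter_eq_zero_of_degree_lt (by omega)]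
    simp

variable {Ω : Type*} [MeasurableSpace Ω] (μ : Measure Ω) [IsProbabilityMeasure μ]

theorem tendsto_integral_pow_mul_bernstein {t : Ω → ℝ} (ht : Measurable t)
    (h0 : ∀ᵐ x ∂μ, 0 < t x) (h1 : ∀ᵐ x ∂μ, t x ≤ 1) (k m : ℕ) :
    Tendsto (fun j : ℕ => ∫ x, t x ^ k * ((j.choose m : ℝ) * t x ^ m * (1 - t x) ^ (j - m)) ∂μ)
      atTop (𝓝 0) := by
  rw [← integral_zero Ω ℝ (μ := μ)]
  refine tendsto_integral_of_dominated_convergence (fun _ => 1) (fun j => ?_)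
    (integrable_const _) (fun j => ?_) ?_
  · exact (by fun_prop : Measurable _).aestronglyMeasurable
  · filter_upwards [h0, h1] with x hx0 hx1
    have hb : 0 ≤ (j.choose m : ℝ) * t x ^ m * (1 - t x) ^ (j - m) := by
      have : 0 ≤ 1 - t x := by linarith
      positivity
    rw [Real.norm_of_nonneg (by positivity)]
    exact mul_le_one₀ (pow_le_one₀ hx0.le hx1) hb (choose_mul_pow_mul_pow_le_one j m hx0.le hx1)
  · filter_upwards [h0, h1] with x hx0 hx1
    simpa using (tendsto_choose_mul_pow_mul_pow m hx0 hx1).const_mul (t x ^ k)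

theorem integrable_pow_of_ae_le_one {t : Ω → ℝ} (ht : Measurable t)
    (h0 : ∀ᵐ x ∂μ, 0 < t x) (h1 : ∀ᵐ x ∂μ, t x ≤ 1) (k : ℕ) :
    Integrable (fun x => t x ^ k) μ := by
  refine (integrable_const (1 : ℝ)).mono' (ht.pow_const k).aestronglyMeasurable ?_
  filter_upwards [h0, h1] with x hx0 hx1
  rw [Real.norm_of_nonneg (by positivity)]
  exact pow_le_one₀ hx0.le hx1

/-- If the moments `∫ t ^ k` of a positive variable `t ≤ 1` are eventually the reciprocals of the
values of a polynomial, then all of them are. -/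
theorem eval_mul_integral_pow_eq_one {t : Ω → ℝ} (ht : Measurable t)
    (h0 : ∀ᵐ x ∂μ, 0 < t x) (h1 : ∀ᵐ x ∂μ, t x ≤ 1) (Q : Polynomial ℝ) (k₀ : ℕ)
    (hQ : ∀ k ≥ k₀, Q.eval (k : ℝ) * ∫ x, t x ^ k ∂μ = 1) (k : ℕ) :
    Q.eval (k : ℝ) * ∫ x, t x ^ k ∂μ = 1 := by
  -- Descending induction: with `i` the distance below `k₀`, the induction hypothesis covers `k + l`
  -- for every `l ≥ 1`.
  suffices H : ∀ i k, k₀ ≤ k + i → Q.eval (k : ℝ) * ∫ x, t x ^ k ∂μ = 1 from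
    H k₀ k (Nat.le_add_left _ _)
  intro i
  induction i with
  | zero => exact fun k hk => hQ k hk
  | succ i ih =>
    intro k hk
    -- In the alternating binomial sum of order `j` over `Q (k + l) ∫ t^(k+l) - 1` only `l = 0`
    -- survives. The constants cancel because `j ≥ 1`, and Newton's formula leaves a number of
    -- Bernstein integrals independent of `j`. They tend to `0` as `j → ∞`, while the left side does
    -- not involve `j`.
    have key : ∀ j : ℕ, 1 ≤ j → Q.eval (k : ℝ) * ∫ x, t x ^ k ∂μ - 1 =
        ∑ m ∈ range (Q.natDegree + 1), ((fwdDiff (1 : ℝ))^[m] Q.eval k) * (-1) ^ m *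
          ∫ x, t x ^ k * ((j.choose m : ℝ) * t x ^ m * (1 - t x) ^ (j - m)) ∂μ := by
      intro j hj
      have e1 : ∑ l ∈ range (j + 1), (-1) ^ l * (j.choose l : ℝ) *
          (Q.eval ((k + l : ℕ) : ℝ) * ∫ x, t x ^ (k + l) ∂μ - 1) =
          Q.eval (k : ℝ) * ∫ x, t x ^ k ∂μ - 1 := by
        rw [sum_eq_single 0]
        · simp
        · intro l _ hl
          rw [ih (k + l) (by omega)]
          simp
        · simp
      have e2 : ∑ l ∈ range (j + 1), (-1 : ℝ) ^ l * (j.choose l : ℝ) = 0 := by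
        have := Int.alternating_sum_range_choose_of_ne (n := j) (by omega)
        exact_mod_cast this
      rw [← e1]
      simp only [mul_sub, mul_one, sum_sub_distrib, e2, sub_zero]
      have e3 : ∀ m, ∫ x, t x ^ k * ((j.choose m : ℝ) * t x ^ m * (1 - t x) ^ (j - m)) ∂μ =
          (-1) ^ m * ∑ l ∈ range (j + 1), (-1) ^ l * (j.choose l : ℝ) * (l.choose m : ℝ) *
            ∫ x, t x ^ (k + l) ∂μ := by
        intro m
        simp_rw [← integral_const_mul]
        rw [← integral_finsetSum _ (fun l _ =>
          (integrable_pow_of_ae_le_one μ ht h0 h1 (k + l)).const_mul _), ← integral_const_mul]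
        refine integral_congr_ae (Eventually.of_forall fun x => ?_)
        have h := sum_neg_one_pow_choose_mul_choose_mul_pow j m (t x)
        have hs : ((-1 : ℝ) ^ m) * (-1) ^ m = 1 := by rw [← mul_pow]; simp
        simp only [pow_add]
        calc _ = ((-1 : ℝ) ^ m) * (-1) ^ m * (t x ^ k *
              ((j.choose m : ℝ) * t x ^ m * (1 - t x) ^ (j - m))) := by rw [hs, one_mul]
          _ = (-1 : ℝ) ^ m * (t x ^ k *
              ((-1) ^ m * ((j.choose m : ℝ) * t x ^ m * (1 - t x) ^ (j - m)))) := by ring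
          _ = _ := by
            rw [← h, mul_sum]
            congr 1
            exact sum_congr rfl fun l _ => by ring
      simp_rw [e3, Polynomial.eval_add_natCast_eq_sum_choose, sum_mul, mul_sum]
      rw [sum_comm]
      refine sum_congr rfl fun m _ => sum_congr rfl fun l _ => ?_
      have hs : ((-1 : ℝ) ^ m) * (-1) ^ m = 1 := by rw [← mul_pow]; simp
      linear_combination (-(fwdDiff (1 : ℝ))^[m] Q.eval k * (-1) ^ l * (j.choose l : ℝ) *
        (l.choose m : ℝ) * ∫ x, t x ^ (k + l) ∂μ) * hs
    have hlim : Tendsto (fun j : ℕ => ∑ m ∈ range (Q.natDegree + 1),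
        ((fwdDiff (1 : ℝ))^[m] Q.eval k) * (-1) ^ m *
          ∫ x, t x ^ k * ((j.choose m : ℝ) * t x ^ m * (1 - t x) ^ (j - m)) ∂μ) atTop (𝓝 0) := by
      rw [← sum_const_zero (s := range (Q.natDegree + 1))]
      refine tendsto_finsetSum _ fun m _ => ?_
      simpa using (tendsto_integral_pow_mul_bernstein μ ht h0 h1 k m).const_mul
        (((fwdDiff (1 : ℝ))^[m] Q.eval k) * (-1) ^ m)
    have hconst := tendsto_const_nhds.congr' (f₁ := fun _ : ℕ => Q.eval (k : ℝ) *
      ∫ x, t x ^ k ∂μ - 1) (eventually_atTop.mpr ⟨1, fun j hj => key j hj⟩)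
    exact sub_eq_zero.mp (tendsto_nhds_unique hconst hlim)

end Moments

/-! ### Krull dimension and the growth of Hilbert functions -/

/-- Chains of primes lift: lying over for the first prime, going up for each further one. -/
theorem ringKrullDim_le_of_isIntegral_injective {A R : Type*} [CommRing A] [CommRing R]
    (f : A →+* R) (hf : f.IsIntegral) (hinj : Function.Injective f) :
    ringKrullDim A ≤ ringKrullDim R := by
  let _ : Algebra A R := f.toAlgebra
  have : Algebra.IsIntegral A R := ⟨hf⟩
  replace hinj : Function.Injective (algebraMap A R) := hinj
  refine iSup_le fun p => ?_
  suffices H : ∃ q : LTSeries (PrimeSpectrum R), q.length = p.length ∧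
      PrimeSpectrum.comap (algebraMap A R) q.last = p.last by
    obtain ⟨q, hq, -⟩ := H
    rw [← hq]
    exact le_iSup (fun q : LTSeries (PrimeSpectrum R) => (q.length : WithBot ℕ∞)) q
  induction p using RelSeries.inductionOn' with
  | singleton x =>
    obtain ⟨Q, -, hQ, hQ'⟩ := Ideal.exists_ideal_over_prime_of_isIntegral x.asIdeal (⊥ : Ideal R)
      (by
        change RingHom.ker (algebraMap A R) ≤ _
        rw [(RingHom.injective_iff_ker_eq_bot _).mp hinj]
        exact bot_le)
    refine ⟨RelSeries.singleton _ ⟨Q, hQ⟩, rfl, ?_⟩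
    ext1
    exact hQ'
  | snoc p x hx ih =>
    obtain ⟨q, hq, hql⟩ := ih
    have hlt : p.last < x := hx
    obtain ⟨Q, hQ1, hQ, hQ'⟩ := Ideal.exists_ideal_over_prime_of_isIntegral_of_isPrime
      x.asIdeal q.last.asIdeal (by
        have : (PrimeSpectrum.comap (algebraMap A R) q.last).asIdeal ≤ x.asIdeal := by
          rw [hql]; exact hlt.le
        exact this)
    have hx' : PrimeSpectrum.comap (algebraMap A R) ⟨Q, hQ⟩ = x := by
      ext1
      exact hQ'
    have hlt' : q.last < ⟨Q, hQ⟩ := by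
      refine lt_of_le_of_ne hQ1 fun h => ?_
      rw [← hx', ← h, hql] at hlt
      exact lt_irrefl _ hlt
    refine ⟨q.snoc ⟨Q, hQ⟩ hlt', ?_, ?_⟩
    · simp [hq]
    · simp [hx']

namespace MvPolynomial

variable {F : Type*} [Field F]

/-- Every exponent is at most `e`, so the coefficients over a cube of `(e + 1) ^ s` exponent vectors
determine the polynomial. -/
theorem finrank_restrictTotalDegree_le (s e : ℕ) :
    Module.Finite F (restrictTotalDegree (Fin s) F e) ∧
      Module.finrank F (restrictTotalDegree (Fin s) F e) ≤ (e + 1) ^ s := by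
  let φ : restrictTotalDegree (Fin s) F e →ₗ[F] ((Fin s → Fin (e + 1)) → F) :=
    LinearMap.pi (fun x => lcoeff F (Finsupp.equivFunOnFinite.symm (fun i => (x i : ℕ)))) ∘ₗ
      Submodule.subtype _
  have hφ : Function.Injective φ := by
    rw [← LinearMap.ker_eq_bot, LinearMap.ker_eq_bot']
    rintro ⟨f, hf⟩ h
    rw [mem_restrictTotalDegree] at hf
    refine Subtype.ext (MvPolynomial.ext _ _ fun a => ?_)
    change coeff a f = coeff a 0
    rw [coeff_zero]
    by_contra ha
    have hdeg : ∀ i, a i < e + 1 := fun i => by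
      have h1 := le_totalDegree (mem_support_iff.mpr ha)
      have h2 := Finsupp.le_degree i a
      rw [Finsupp.degree_apply] at h2
      have h3 : (a.sum fun _ e => e) = ∑ i ∈ a.support, a i := rfl
      omega
    have h4 := congrFun h (fun i => ⟨a i, hdeg i⟩)
    have h5 : Finsupp.equivFunOnFinite.symm (fun i => a i) = a := by
      ext i
      simp
    change coeff (Finsupp.equivFunOnFinite.symm (fun i => a i)) f = 0 at h4
    exact ha (h5 ▸ h4)
  have : Module.Finite F (restrictTotalDegree (Fin s) F e) := Module.Finite.of_injective φ hφ
  refine ⟨this, (LinearMap.finrank_le_finrank_of_injective hφ).trans ?_⟩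
  simp

/-- Polynomials of degree at most `k` span a space of dimension `O(k ^ s)` in an algebra that is
finite over a polynomial ring in `s` variables. -/
theorem exists_finrank_map_restrictTotalDegree_le {n s : ℕ} {R : Type*} [CommRing R] [Algebra F R]
    (q : MvPolynomial (Fin n) F →ₐ[F] R) (g : MvPolynomial (Fin s) F →ₐ[F] R) (hg : g.Finite) :
    ∃ C : ℕ, ∀ k, Module.finrank F ((restrictTotalDegree (Fin n) F k).map q.toLinearMap) ≤
      C * (k + 1) ^ s := by
  classical
  let _ : Algebra (MvPolynomial (Fin s) F) R := g.toRingHom.toAlgebra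
  have hfin : Module.Finite (MvPolynomial (Fin s) F) R := hg
  have hsmul : ∀ (p : MvPolynomial (Fin s) F) (x : R), p • x = g p * x := fun p x => rfl
  obtain ⟨r, m, hm⟩ := Module.Finite.exists_fin (R := MvPolynomial (Fin s) F) (M := R)
  have hrep : ∀ x : R, ∃ a : Fin r → MvPolynomial (Fin s) F, ∑ l, g (a l) * m l = x := by
    intro x
    have : x ∈ Submodule.span (MvPolynomial (Fin s) F) (Set.range m) := hm ▸ Submodule.mem_top
    exact (Submodule.mem_span_range_iff_exists_fun _).mp this
  choose a ha using fun (i : Fin n) (j : Fin r) => hrep (q (X i) * m j)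
  obtain ⟨b, hb⟩ := hrep 1
  -- A bound for the degrees of the coefficients in `X_i m_j = ∑ a_{ijl} m_l` and `1 = ∑ b_l m_l`.
  -- Multiplication by a variable then raises the degree of coefficients by at most `c`.
  let c : ℕ := (Finset.univ.sup fun i => Finset.univ.sup fun j => Finset.univ.sup fun l =>
    (a i j l).totalDegree) ⊔ Finset.univ.sup fun l => (b l).totalDegree
  have hac : ∀ i j l, (a i j l).totalDegree ≤ c := fun i j l =>
    ((Finset.le_sup (f := fun l => (a i j l).totalDegree) (Finset.mem_univ l)).trans
      ((Finset.le_sup (f := fun j => Finset.univ.sup fun l => (a i j l).totalDegree)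
        (Finset.mem_univ j)).trans (Finset.le_sup (f := fun i => Finset.univ.sup fun j =>
          Finset.univ.sup fun l => (a i j l).totalDegree) (Finset.mem_univ i)))).trans le_sup_left
  have hbc : ∀ l, (b l).totalDegree ≤ c := fun l =>
    (Finset.le_sup (f := fun l => (b l).totalDegree) (Finset.mem_univ l)).trans le_sup_right
  let ψ (e : ℕ) : (Fin r → restrictTotalDegree (Fin s) F e) →ₗ[F] R :=
    ∑ l, (LinearMap.mulRight F (m l)) ∘ₗ g.toLinearMap ∘ₗ (Submodule.subtype _) ∘ₗ
      (LinearMap.proj l)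
  have hψ : ∀ e x, ψ e x = ∑ l, g (x l) * m l := fun e x => by simp [ψ, LinearMap.sum_apply]
  have hmem : ∀ e (p : Fin r → MvPolynomial (Fin s) F), (∀ l, (p l).totalDegree ≤ e) →
      ∑ l, g (p l) * m l ∈ LinearMap.range (ψ e) := fun e p hp =>
    ⟨fun l => ⟨p l, (mem_restrictTotalDegree _ _ _).mpr (hp l)⟩, hψ _ _⟩
  have hmono : ∀ e e', e ≤ e' → LinearMap.range (ψ e) ≤ LinearMap.range (ψ e') := by
    rintro e e' hee _ ⟨x, rfl⟩
    rw [hψ]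
    exact hmem e' (fun l => x l) fun l => ((mem_restrictTotalDegree _ _ _).mp (x l).2).trans hee
  have hX : ∀ i e x, x ∈ LinearMap.range (ψ e) → q (X i) * x ∈ LinearMap.range (ψ (e + c)) := by
    rintro i e _ ⟨x, rfl⟩
    rw [hψ]
    have : q (X i) * ∑ j, g (x j) * m j = ∑ l, g (∑ j, x j * a i j l) * m l := by
      simp only [map_sum, map_mul, Finset.sum_mul, Finset.mul_sum]
      rw [Finset.sum_comm]
      refine Finset.sum_congr rfl fun j _ => ?_
      rw [mul_left_comm, ← ha i j, Finset.mul_sum]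
      exact Finset.sum_congr rfl fun l _ => by ring
    rw [this]
    refine hmem _ _ fun l => (totalDegree_finsetSum _ _).trans (Finset.sup_le fun j _ => ?_)
    refine (totalDegree_mul _ _).trans (add_le_add ?_ (hac i j l))
    exact (mem_restrictTotalDegree _ _ _).mp (x j).2
  have hone : (1 : R) ∈ LinearMap.range (ψ c) := hb ▸ hmem c b hbc
  have hmon : ∀ d : ℕ, ∀ u : Fin n →₀ ℕ, u.degree = d →
      q (monomial u 1) ∈ LinearMap.range (ψ (c * (d + 1))) := by
    intro d
    induction d with
    | zero =>
      intro u hu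
      rw [Finsupp.degree_eq_zero_iff] at hu
      subst hu
      rw [zero_add, mul_one]
      simpa using hone
    | succ d ih =>
      intro u hu
      have hne : u ≠ 0 := by
        rintro rfl
        simp at hu
      obtain ⟨i, hi⟩ := Finsupp.ne_iff.mp hne
      have hle : Finsupp.single i 1 ≤ u :=
        Finsupp.single_le_iff.mpr (Nat.one_le_iff_ne_zero.mpr hi)
      have hu' : u = Finsupp.single i 1 + (u - Finsupp.single i 1) :=
        (add_tsub_cancel_of_le hle).symm
      have hd : (u - Finsupp.single i 1).degree = d := by
        have := congrArg Finsupp.degree hu'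
        rw [map_add, Finsupp.degree_single, hu] at this
        omega
      have h1 := hX i _ _ (ih _ hd)
      rw [← map_mul, X, monomial_mul, one_mul, ← hu'] at h1
      exact hmono _ _ (by ring_nf; rfl) h1
  have hsub : ∀ k, (restrictTotalDegree (Fin n) F k).map q.toLinearMap ≤
      LinearMap.range (ψ (c * (k + 1))) := by
    rintro k _ ⟨f, hf, rfl⟩
    rw [SetLike.mem_coe, mem_restrictTotalDegree] at hf
    rw [AlgHom.toLinearMap_apply, f.as_sum, map_sum]
    refine Submodule.sum_mem _ fun u hu => ?_
    have h1 : u.degree ≤ k := (le_totalDegree hu).trans hf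
    have h2 := hmono _ (c * (k + 1)) (by gcongr) (hmon _ u rfl)
    have h3 : monomial u (coeff u f) = coeff u f • monomial u (1 : F) := by
      rw [smul_monomial, smul_eq_mul, mul_one]
    rw [h3, map_smul]
    exact Submodule.smul_mem _ _ h2
  refine ⟨r * (c + 1) ^ s, fun k => ?_⟩
  obtain ⟨hfd, hle⟩ := finrank_restrictTotalDegree_le (F := F) s (c * (k + 1))
  calc _ ≤ Module.finrank F (LinearMap.range (ψ (c * (k + 1)))) := Submodule.finrank_mono (hsub k)
    _ ≤ Module.finrank F (Fin r → restrictTotalDegree (Fin s) F (c * (k + 1))) :=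
      LinearMap.finrank_range_le _
    _ = r * Module.finrank F (restrictTotalDegree (Fin s) F (c * (k + 1))) := by
      rw [Module.finrank_pi_fintype]
      simp
    _ ≤ r * ((c + 1) * (k + 1)) ^ s := by
      gcongr
      refine hle.trans ?_
      gcongr
      nlinarith
    _ = _ := by rw [mul_pow, mul_assoc]

/-- The Hilbert function counts dimensions in the quotient ring. -/
theorem sum_finrank_le_finrank_map {n : ℕ} {I : Ideal (MvPolynomial (Fin n) F)}
    (hI : ContainsComponents I) (H : ℕ → Submodule F (MvPolynomial (Fin n) F))
    (hH : ∀ k, H k ≤ homogeneousSubmodule (Fin n) F k) (hHI : ∀ k, ∀ f ∈ H k, f ∈ I → f = 0)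
    (k : ℕ) :
    ∑ j ∈ Finset.range (k + 1), Module.finrank F (H j) ≤ Module.finrank F
      ((restrictTotalDegree (Fin n) F k).map (Ideal.Quotient.mkₐ F I).toLinearMap) := by
  have hfin : ∀ j, Module.Finite F (H j) := fun j => Submodule.finiteDimensional_of_le (hH j)
  have hfd := (finrank_restrictTotalDegree_le (F := F) n k).1
  let σ : (∀ j : Fin (k + 1), H j) →ₗ[F] MvPolynomial (Fin n) F :=
    ∑ j, (Submodule.subtype _) ∘ₗ (LinearMap.proj j)
  have hσ : ∀ x, σ x = ∑ j, (x j : MvPolynomial (Fin n) F) := fun x => by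
    simp [σ, LinearMap.sum_apply]
  have hcomp : ∀ x (j : Fin (k + 1)), homogeneousComponent j (σ x) = x j := by
    intro x j
    rw [hσ, map_sum, Finset.sum_eq_single j]
    · exact homogeneousComponent_eq_self (hH _ (x j).2)
    · intro i _ hij
      rw [homogeneousComponent_of_mem (hH _ (x i).2), if_neg]
      exact fun h => hij (Fin.ext h.symm)
    · simp
  let τ : (∀ j : Fin (k + 1), H j) →ₗ[F]
      (restrictTotalDegree (Fin n) F k).map (Ideal.Quotient.mkₐ F I).toLinearMap :=
    ((Ideal.Quotient.mkₐ F I).toLinearMap ∘ₗ σ).codRestrict _ (fun x => by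
      refine Submodule.mem_map_of_mem ?_
      rw [mem_restrictTotalDegree, hσ]
      refine (totalDegree_finsetSum _ _).trans (Finset.sup_le fun j _ => ?_)
      have h1 : (x j : MvPolynomial (Fin n) F).IsHomogeneous j := hH _ (x j).2
      exact h1.totalDegree_le.trans (Nat.lt_succ_iff.mp j.2))
  -- If the sum lies in `I`, so does each of its components, and `H j` meets `I` only in zero.
  have hτ : Function.Injective τ := by
    rw [← LinearMap.ker_eq_bot, LinearMap.ker_eq_bot']
    intro x hx
    have h1 : Ideal.Quotient.mk I (σ x) = 0 := congrArg Subtype.val hx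
    rw [Ideal.Quotient.eq_zero_iff_mem] at h1
    funext j
    have h2 := hI _ h1 j
    rw [hcomp] at h2
    exact Subtype.ext (hHI _ _ (x j).2 h2)
  have h := LinearMap.finrank_le_finrank_of_injective hτ
  rwa [Module.finrank_pi_fintype, Fin.sum_univ_eq_sum_range (fun j => Module.finrank F (H j))] at h

end MvPolynomial

-- If the degree exceeded `d`, then `h j ≥ j^(d+1) / B` for large `j`. The block `k ≤ j < 2k` alone
-- would contribute order `k^(d+2)`, more than the allowed `C (2k + 1)^(d+1) ≤ C (3k)^(d+1)`.
open Filter Asymptotics in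
theorem Polynomial.natDegree_le_of_sum_le (Q : Polynomial ℝ) (h : ℕ → ℕ) (k₀ d C : ℕ)
    (hQ : ∀ k ≥ k₀, (h k : ℝ) = Q.eval (k : ℝ))
    (hsum : ∀ k, ∑ j ∈ Finset.range (k + 1), h j ≤ C * (k + 1) ^ (d + 1)) : Q.natDegree ≤ d := by
  by_contra hd
  rw [not_le] at hd
  have hQ0 : Q ≠ 0 := by
    rintro rfl
    simp at hd
  have hdeg : (Polynomial.X ^ (d + 1) : Polynomial ℝ).degree ≤ Q.degree := by
    rw [Polynomial.degree_X_pow, Polynomial.degree_eq_natDegree hQ0]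
    exact_mod_cast hd
  obtain ⟨B, hB, hO⟩ := (Polynomial.isBigO_atTop_of_degree_le _ _ hdeg).exists_pos
  obtain ⟨k₁, hk₁⟩ := eventually_atTop.mp (tendsto_natCast_atTop_atTop.eventually hO.bound)
  obtain ⟨k₂, hk₂⟩ := exists_nat_gt (B * (C * 3 ^ (d + 1)))
  set k := max (max k₀ k₁) (max k₂ 1) with hk
  have hk0 : k₀ ≤ k := (le_max_left _ _).trans (le_max_left _ _)
  have hk1 : k₁ ≤ k := (le_max_right _ _).trans (le_max_left _ _)
  have hk2 : k₂ ≤ k := (le_max_left _ _).trans (le_max_right _ _)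
  have hk3 : 1 ≤ k := (le_max_right _ _).trans (le_max_right _ _)
  have hlow : ∀ j ∈ Finset.Ico k (2 * k), (k : ℝ) ^ (d + 1) ≤ B * h j := by
    intro j hj
    rw [Finset.mem_Ico] at hj
    have h1 := hk₁ j (hk1.trans hj.1)
    rw [← hQ j (hk0.trans hj.1)] at h1
    simp only [eval_pow, eval_X, norm_pow, Real.norm_natCast] at h1
    refine le_trans ?_ h1
    gcongr
    exact hj.1
  have h2 : (k : ℝ) * (k : ℝ) ^ (d + 1) ≤ B * (C * 3 ^ (d + 1)) * (k : ℝ) ^ (d + 1) := by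
    calc (k : ℝ) * (k : ℝ) ^ (d + 1) = ∑ j ∈ Finset.Ico k (2 * k), (k : ℝ) ^ (d + 1) := by
          rw [Finset.sum_const, Nat.card_Ico, nsmul_eq_mul, show 2 * k - k = k by omega]
      _ ≤ ∑ j ∈ Finset.Ico k (2 * k), B * h j := Finset.sum_le_sum hlow
      _ ≤ ∑ j ∈ Finset.range (2 * k + 1), B * h j := by
          refine Finset.sum_le_sum_of_subset_of_nonneg (fun j hj => ?_) (fun j _ _ => by positivity)
          rw [Finset.mem_Ico] at hj
          exact Finset.mem_range.mpr (by omega)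
      _ = B * ((∑ j ∈ Finset.range (2 * k + 1), h j : ℕ) : ℝ) := by
          rw [← Finset.mul_sum]
          push_cast
          rfl
      _ ≤ B * ((C * (3 * k) ^ (d + 1) : ℕ) : ℝ) := by
          have h3 : C * (2 * k + 1) ^ (d + 1) ≤ C * (3 * k) ^ (d + 1) := by
            gcongr
            omega
          have h4 := (hsum (2 * k)).trans h3
          gcongr
      _ = _ := by
          push_cast
          ring
  have h5 : (0 : ℝ) < (k : ℝ) ^ (d + 1) := by positivity
  have h6 := le_of_mul_le_mul_right h2 h5
  have h7 : (k₂ : ℝ) ≤ k := by exact_mod_cast hk2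
  linarith

namespace MvPolynomial

variable {F : Type*} [Field F]

/-- The degree of the Hilbert polynomial is less than the dimension of the coordinate ring. -/
theorem natDegree_hilbertPolynomial_le {n d : ℕ} {I : Ideal (MvPolynomial (Fin n) F)}
    (hI : ContainsComponents I)
    (hd : ringKrullDim (MvPolynomial (Fin n) F ⧸ I) = ((d + 1 : ℕ) : WithBot ℕ∞))
    (H : ℕ → Submodule F (MvPolynomial (Fin n) F))
    (hH : ∀ k, H k ≤ homogeneousSubmodule (Fin n) F k) (hHI : ∀ k, ∀ f ∈ H k, f ∈ I → f = 0)
    (Q : Polynomial ℝ) (k₀ : ℕ)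
    (hQ : ∀ k ≥ k₀, (Module.finrank F (H k) : ℝ) = Q.eval (k : ℝ)) : Q.natDegree ≤ d := by
  have hnt : Nontrivial (MvPolynomial (Fin n) F ⧸ I) := by
    by_contra h
    rw [not_nontrivial_iff_subsingleton] at h
    rw [ringKrullDim_eq_bot_of_subsingleton] at hd
    exact WithBot.bot_ne_coe hd
  -- Noether normalization: the number `s` of variables is at most the Krull dimension and is also
  -- the growth exponent of the summed Hilbert function.
  obtain ⟨s, g, hinj, hfin⟩ := exists_finite_inj_algHom_of_fg F (MvPolynomial (Fin n) F ⧸ I)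
  have hs : s ≤ d + 1 := by
    have h := ringKrullDim_le_of_isIntegral_injective g.toRingHom hfin.to_isIntegral hinj
    rw [hd, ringKrullDim_of_isNoetherianRing, ringKrullDim_eq_zero_of_field, zero_add] at h
    simp only [Nat.card_eq_fintype_card, Fintype.card_fin] at h
    exact_mod_cast h
  obtain ⟨C, hC⟩ := exists_finrank_map_restrictTotalDegree_le (Ideal.Quotient.mkₐ F I) g hfin
  refine Q.natDegree_le_of_sum_le _ k₀ d C hQ fun k => ?_
  refine (sum_finrank_le_finrank_map hI H hH hHI k).trans ((hC k).trans ?_)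
  gcongr
  omega

end MvPolynomial

/-! ### Reproducing kernels of the Drury–Arveson space -/

namespace MvPolynomial

theorem IsHomogeneous.eval_smul {σ F : Type*} [Fintype σ] [Field F] {f : MvPolynomial σ F} {k : ℕ}
    (hf : f.IsHomogeneous k) (c : F) (z : σ → F) : eval (c • z) f = c ^ k * eval z f := by
  rw [eval_eq', eval_eq', Finset.mul_sum]
  refine Finset.sum_congr rfl fun a ha => ?_
  have hdeg : ∑ i, a i = k := by
    rw [← Finsupp.degree_eq_sum]
    by_contra h
    exact mem_support_iff.mp ha (hf.coeff_eq_zero h)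
  simp only [Pi.smul_apply, smul_eq_mul, mul_pow]
  rw [Finset.prod_mul_distrib, Finset.prod_pow_eq_pow_sum, hdeg]
  ring

theorem eval_smul_eq_sum {σ F : Type*} [Fintype σ] [Field F] (f : MvPolynomial σ F) (c : F)
    (z : σ → F) : eval (c • z) f =
      ∑ k ∈ Finset.range (f.totalDegree + 1), c ^ k * eval z (homogeneousComponent k f) := by
  conv_lhs => rw [← sum_homogeneousComponent f, map_sum]
  exact Finset.sum_congr rfl fun k _ => (homogeneousComponent_isHomogeneous k f).eval_smul c z

/-- If a polynomial vanishes at infinitely many multiples of a point, then so do its homogeneous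
components. -/
theorem eval_homogeneousComponent_eq_zero {σ F : Type*} [Fintype σ] [Field F] {S : Set F}
    (hS : S.Infinite) (f : MvPolynomial σ F) (z : σ → F) (h : ∀ c ∈ S, eval (c • z) f = 0) (k : ℕ) :
    eval z (homogeneousComponent k f) = 0 := by
  -- The polynomial `c ↦ f (c z)`, whose coefficients are the values of the homogeneous components
  -- at `z`.
  let p : Polynomial F := ∑ k ∈ Finset.range (f.totalDegree + 1),
    Polynomial.monomial k (eval z (homogeneousComponent k f))
  have hp : p = 0 := by
    refine Polynomial.eq_zero_of_infinite_isRoot p (hS.mono fun c hc => ?_)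
    have := h c hc
    rw [eval_smul_eq_sum] at this
    simp only [p, Set.mem_ofPred_eq, Polynomial.IsRoot, Polynomial.eval_finsetSum,
      Polynomial.eval_monomial]
    rw [← this]
    exact Finset.sum_congr rfl fun k _ => mul_comm _ _
  by_cases hk : k < f.totalDegree + 1
  · have h1 : p.coeff k = 0 := by rw [hp, Polynomial.coeff_zero]
    simp only [p, Polynomial.finsetSum_coeff, Polynomial.coeff_monomial] at h1
    simpa [Finset.sum_ite_eq', hk] using h1
  · rw [homogeneousComponent_eq_zero _ _ (by omega), map_zero]

/-- The `k`-th power of the linear form `z ↦ ⟨z, w⟩`. -/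
noncomputable def kernelPoly {n : ℕ} (k : ℕ) (w : Fin n → ℂ) : MvPolynomial (Fin n) ℂ :=
  (∑ i, star (w i) • X i) ^ k

theorem kernelPoly_isHomogeneous {n : ℕ} (k : ℕ) (w : Fin n → ℂ) :
    (kernelPoly k w).IsHomogeneous k := by
  have h : (∑ i, star (w i) • X i : MvPolynomial (Fin n) ℂ).IsHomogeneous 1 := by
    refine IsHomogeneous.sum _ _ _ fun i _ => ?_
    rw [smul_eq_C_mul]
    exact (isHomogeneous_X _ i).C_mul _
  simpa [kernelPoly] using h.pow k

theorem eval_kernelPoly {n : ℕ} (k : ℕ) (w z : Fin n → ℂ) :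
    eval z (kernelPoly k w) = (z ⬝ᵥ star w) ^ k := by
  simp [kernelPoly, dotProduct, smul_eval, mul_comm]

end MvPolynomial

open MvPolynomial

theorem monomialNormSq_pos {n : ℕ} (a : Fin n →₀ ℕ) : 0 < monomialNormSq a := by
  unfold monomialNormSq
  have : 0 < ∏ i, (a i).factorial := Finset.prod_pos fun i _ => Nat.factorial_pos _
  positivity

theorem monomialNormSq_mul_multinomial {n : ℕ} (a : Fin n →₀ ℕ) :
    monomialNormSq a * (a.multinomial : ℝ) = 1 := by
  have h := Nat.multinomial_spec (Finset.univ : Finset (Fin n)) a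
  rw [← Finsupp.multinomial_eq_of_support_subset (Finset.subset_univ _),
    ← Finsupp.degree_eq_sum] at h
  have h0 : ((a.degree).factorial : ℝ) ≠ 0 := by positivity
  rw [monomialNormSq, div_mul_eq_mul_div, ← Nat.cast_mul, h, div_self h0]

theorem polyToDruryArveson_monomial {n : ℕ} (a : Fin n →₀ ℕ) (c : ℂ) :
    polyToDruryArveson n (monomial a c) =
      c • lp.single 2 a ((Real.sqrt (monomialNormSq a) : ℝ) : ℂ) := by
  have h : monomial a c = c • basisMonomials (Fin n) ℂ a := by
    rw [coe_basisMonomials, smul_monomial, smul_eq_mul, mul_one]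
  rw [h, map_smul, polyToDruryArveson, Module.Basis.constr_basis]

theorem polyToDruryArveson_apply {n : ℕ} (f : MvPolynomial (Fin n) ℂ) (a : Fin n →₀ ℕ) :
    polyToDruryArveson n f a = ((Real.sqrt (monomialNormSq a) : ℝ) : ℂ) * coeff a f := by
  induction f using MvPolynomial.induction_on' with
  | monomial b c =>
    rw [polyToDruryArveson_monomial, lp.coeFn_smul, Pi.smul_apply, coeff_monomial]
    by_cases h : b = a
    · subst h
      rw [lp.single_apply_self, if_pos rfl, smul_eq_mul, mul_comm]
    · rw [lp.single_apply_ne _ _ _ (Ne.symm h), if_neg h, smul_zero, mul_zero]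
  | add p q hp hq =>
    rw [map_add, lp.coeFn_add, Pi.add_apply, hp, hq, coeff_add, mul_add]

theorem polyToDruryArveson_injective (n : ℕ) : Function.Injective (polyToDruryArveson n) := by
  intro f g h
  ext a
  have h1 := congrArg (fun x : DruryArveson n => x a) h
  simp only [polyToDruryArveson_apply] at h1
  refine mul_left_cancel₀ ?_ h1
  exact_mod_cast (Real.sqrt_pos.mpr (monomialNormSq_pos a)).ne'

theorem polyToDruryArveson_denseRange (n : ℕ) : DenseRange (polyToDruryArveson n) := by
  have hcl : (LinearMap.range (polyToDruryArveson n)).topologicalClosure = ⊤ := by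
    rw [eq_top_iff]
    intro x _
    refine (isClosed_closure (s := (LinearMap.range (polyToDruryArveson n) :
      Set (DruryArveson n)))).mem_of_tendsto (lp.hasSum_single (by norm_num) x)
      (Filter.Eventually.of_forall fun s => subset_closure ?_)
    refine Submodule.sum_mem _ fun a _ => ?_
    have h0 : ((Real.sqrt (monomialNormSq a) : ℝ) : ℂ) ≠ 0 := by
      exact_mod_cast (Real.sqrt_pos.mpr (monomialNormSq_pos a)).ne'
    refine ⟨monomial a (x a / ((Real.sqrt (monomialNormSq a) : ℝ) : ℂ)), ?_⟩
    rw [polyToDruryArveson_monomial, ← lp.single_smul, smul_eq_mul, div_mul_cancel₀ _ h0]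
  rw [DenseRange, ← LinearMap.coe_range]
  exact Submodule.dense_iff_topologicalClosure_eq_top.mpr hcl

/-- The multinomial coefficient of `z^a` in `⟨z, w⟩^k` is the inverse of the squared norm of `z^a`,
so `⟨·, w⟩^k` is the reproducing kernel in degree `k`. -/
theorem inner_polyToDruryArveson_kernelPoly {n : ℕ} (k : ℕ) (w : Fin n → ℂ)
    (f : MvPolynomial (Fin n) ℂ) :
    inner ℂ (polyToDruryArveson n (kernelPoly k w)) (polyToDruryArveson n f) =
      eval w (homogeneousComponent k f) := by
  induction f using MvPolynomial.induction_on' with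
  | monomial a c =>
    have hs : ((Real.sqrt (monomialNormSq a) : ℝ) : ℂ) * ((Real.sqrt (monomialNormSq a) : ℝ) : ℂ) =
        (monomialNormSq a : ℂ) := by
      rw [← Complex.ofReal_mul, Real.mul_self_sqrt (monomialNormSq_pos a).le]
    rw [polyToDruryArveson_monomial, inner_smul_right, lp.inner_single_right,
      polyToDruryArveson_apply, kernelPoly, coeff_linearCombination_X_pow_of_fintype,
      homogeneousComponent_of_mem (isHomogeneous_monomial c rfl)]
    have hdeg : (a.sum fun _ m => m) = a.degree := rfl
    rw [hdeg]
    by_cases hk : a.degree = k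
    · rw [if_pos hk, if_pos hk.symm, eval_monomial, RCLike.inner_apply]
      simp only [map_mul, Complex.conj_ofReal, Finsupp.prod, map_prod, map_pow, map_natCast]
      have hm : (monomialNormSq a : ℂ) * (a.multinomial : ℂ) = 1 := by
        exact_mod_cast congrArg (fun x : ℝ => (x : ℂ)) (monomialNormSq_mul_multinomial a)
      have hw : ∀ i, (starRingEnd ℂ) (star (w i)) = w i := fun i => star_star (w i)
      simp only [hw]
      linear_combination c * (a.multinomial : ℂ) * (∏ i ∈ a.support, w i ^ a i) * hs +
        c * (∏ i ∈ a.support, w i ^ a i) * hm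
    · rw [if_neg hk, if_neg (Ne.symm hk)]
      simp
  | add p q hp hq => rw [map_add, inner_add_right, hp, hq, map_add, map_add]

theorem inner_polyToDruryArveson_of_ne {n k l : ℕ} (hkl : k ≠ l) {f g : MvPolynomial (Fin n) ℂ}
    (hf : f.IsHomogeneous k) (hg : g.IsHomogeneous l) :
    inner ℂ (polyToDruryArveson n f) (polyToDruryArveson n g) = 0 := by
  rw [lp.inner_eq_tsum]
  refine (tsum_congr fun a => ?_).trans tsum_zero
  rw [polyToDruryArveson_apply, polyToDruryArveson_apply]
  by_cases h : a.degree = k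
  · rw [hg.coeff_eq_zero (by omega), mul_zero, inner_zero_right]
  · rw [hf.coeff_eq_zero h, mul_zero, inner_zero_left]

/-- The weight `√(b_α / |b|)` is the ratio of the norms of `z^b` and `z^b / z_α`. -/
theorem druryArvesonShift_polyToDruryArveson {n : ℕ} (α : Fin n) (f : MvPolynomial (Fin n) ℂ) :
    druryArvesonShift α (polyToDruryArveson n f) = polyToDruryArveson n (X α * f) := by
  ext b
  change shiftFun α (polyToDruryArveson n f) b = _
  rw [shiftFun, polyToDruryArveson_apply, polyToDruryArveson_apply, coeff_X_mul']
  by_cases hb : α ∈ b.support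
  · rw [if_pos hb, ← mul_assoc, ← Complex.ofReal_mul, ← Real.sqrt_mul (by positivity)]
    congr 3
    have hb0 : b α ≠ 0 := Finsupp.mem_support_iff.mp hb
    have hle : Finsupp.single α 1 ≤ b :=
      Finsupp.single_le_iff.mpr (Nat.one_le_iff_ne_zero.mpr hb0)
    obtain ⟨c, rfl⟩ := exists_add_of_le hle
    rw [add_tsub_cancel_left]
    simp only [monomialNormSq, map_add, Finsupp.degree_single, Finsupp.add_apply,
      Finsupp.single_eq_same]
    have h1 : ∏ i, (Finsupp.single α 1 i + c i).factorial =
        (1 + c α) * ∏ i, (c i).factorial := by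
      rw [← Finset.mul_prod_erase _ _ (Finset.mem_univ α),
        ← Finset.mul_prod_erase _ (fun i => (c i).factorial) (Finset.mem_univ α),
        Finsupp.single_eq_same, add_comm 1, Nat.factorial_succ, mul_assoc]
      congr 2
      refine Finset.prod_congr rfl fun i hi => ?_
      rw [Finsupp.single_eq_of_ne (Finset.ne_of_mem_erase hi), zero_add]
    rw [h1, add_comm 1 c.degree, Nat.factorial_succ]
    have h2 : (c.degree.factorial : ℝ) ≠ 0 := by positivity
    have h3 : (c.degree : ℝ) + 1 ≠ 0 := by positivity
    push_cast
    field_simp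
  · rw [if_neg hb, mul_zero, Finsupp.notMem_support_iff.mp hb]
    simp

/-! ### The graded quotient module of a projective set -/

section QuotientModule

variable {n : ℕ} (M : Set (ℙ ℂ (Fin n → ℂ)))

variable {M} in
theorem smul_mem_puncturedCone {z : Fin n → ℂ} (hz : z ∈ puncturedCone M) {c : ℂ} (hc : c ≠ 0) :
    c • z ∈ puncturedCone M := by
  obtain ⟨h0, hM⟩ := hz
  refine ⟨smul_ne_zero hc h0, ?_⟩
  convert hM using 1
  rw [Projectivization.mk_eq_mk_iff']
  exact ⟨c, rfl⟩

theorem mem_homogeneousIdeal {f : MvPolynomial (Fin n) ℂ} :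
    f ∈ homogeneousIdeal M ↔ ∀ z ∈ puncturedCone M, eval z f = 0 := by
  simp [homogeneousIdeal, mem_vanishingIdeal_iff]

theorem containsComponents_homogeneousIdeal : ContainsComponents (homogeneousIdeal M) := by
  intro f hf k
  rw [mem_homogeneousIdeal] at hf ⊢
  intro z hz
  exact eval_homogeneousComponent_eq_zero (Set.finite_singleton (0 : ℂ)).infinite_compl f z
    (fun c hc => hf _ (smul_mem_puncturedCone hz hc)) k

/-- The span of the degree `k` kernels of the points of the cone over `M`. -/
noncomputable def kernelSpan (k : ℕ) : Submodule ℂ (MvPolynomial (Fin n) ℂ) :=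
  Submodule.span ℂ (kernelPoly k '' puncturedCone M)

theorem kernelSpan_le (k : ℕ) : kernelSpan M k ≤ homogeneousSubmodule (Fin n) ℂ k := by
  refine Submodule.span_le.mpr ?_
  rintro _ ⟨w, _, rfl⟩
  exact kernelPoly_isHomogeneous k w

instance kernelSpan_finite (k : ℕ) : Module.Finite ℂ (kernelSpan M k) :=
  Submodule.finiteDimensional_of_le (kernelSpan_le M k)

theorem mem_quotientModule {x : DruryArveson n} : x ∈ quotientModule M ↔
    ∀ f ∈ homogeneousIdeal M, inner ℂ (polyToDruryArveson n f) x = 0 := by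
  rw [quotientModule, Submodule.mem_orthogonal]
  constructor
  · exact fun h f hf => h _ ⟨f, hf, rfl⟩
  · rintro h _ ⟨f, hf, rfl⟩
    exact h f hf

theorem polyToDruryArveson_mem_quotientModule {k : ℕ} {h : MvPolynomial (Fin n) ℂ}
    (hh : h ∈ kernelSpan M k) : polyToDruryArveson n h ∈ quotientModule M := by
  have hle : kernelSpan M k ≤ (quotientModule M).comap (polyToDruryArveson n) := by
    refine Submodule.span_le.mpr ?_
    rintro _ ⟨w, hw, rfl⟩
    refine (mem_quotientModule M).mpr fun f hf => ?_
    rw [← inner_conj_symm, inner_polyToDruryArveson_kernelPoly,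
      (mem_homogeneousIdeal M).mp (containsComponents_homogeneousIdeal M f hf k) w hw, map_zero]
  exact hle hh

theorem eq_zero_of_mem_kernelSpan {k : ℕ} {h : MvPolynomial (Fin n) ℂ}
    (hh : h ∈ kernelSpan M k) (hI : h ∈ homogeneousIdeal M) : h = 0 := by
  have h1 := (mem_quotientModule M).mp (polyToDruryArveson_mem_quotientModule M hh) h hI
  rw [inner_self_eq_zero] at h1
  exact polyToDruryArveson_injective n (h1.trans (map_zero _).symm)

/-- The remainder after orthogonal projection to the kernel span is orthogonal to the kernels of the
cone, that is, it vanishes on the cone. -/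
theorem exists_sub_mem_of_isHomogeneous {k : ℕ} {f : MvPolynomial (Fin n) ℂ}
    (hf : f.IsHomogeneous k) : ∃ h ∈ kernelSpan M k, f - h ∈ homogeneousIdeal M := by
  let K : Submodule ℂ (DruryArveson n) := (kernelSpan M k).map (polyToDruryArveson n)
  obtain ⟨h, hh, hhp⟩ : K.starProjection (polyToDruryArveson n f) ∈ K :=
    Submodule.starProjection_apply_mem _ _
  refine ⟨h, hh, (mem_homogeneousIdeal M).mpr fun w hw => ?_⟩
  have hhom : (f - h).IsHomogeneous k := hf.sub (kernelSpan_le M k hh)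
  rw [← homogeneousComponent_eq_self hhom, ← inner_polyToDruryArveson_kernelPoly, map_sub, hhp]
  exact Submodule.sub_starProjection_mem_orthogonal (K := K) _ _
    ⟨_, Submodule.subset_span ⟨w, hw, rfl⟩, rfl⟩

/-- The kernel span complements the degree `k` part of the ideal, so its dimension is the Hilbert
function of the coordinate ring. -/
theorem finrank_kernelSpan (k : ℕ) :
    (Module.finrank ℂ (kernelSpan M k) : ℚ) =
      (Module.finrank ℂ (homogeneousSubmodule (Fin n) ℂ k) : ℚ) -
        Module.finrank ℂ (gradedPiece (homogeneousIdeal M) k) := by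
  have h := Submodule.finrank_sup_add_finrank_inf_eq (kernelSpan M k)
    (gradedPiece (homogeneousIdeal M) k)
  have h1 : kernelSpan M k ⊔ gradedPiece (homogeneousIdeal M) k =
      homogeneousSubmodule (Fin n) ℂ k := by
    refine le_antisymm (sup_le (kernelSpan_le M k) inf_le_right) fun f hf => ?_
    obtain ⟨g, hg, hfg⟩ := exists_sub_mem_of_isHomogeneous M hf
    rw [← add_sub_cancel g f]
    exact Submodule.add_mem_sup hg ⟨hfg, IsHomogeneous.sub hf (kernelSpan_le M k hg)⟩
  have h2 : kernelSpan M k ⊓ gradedPiece (homogeneousIdeal M) k = ⊥ := by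
    rw [eq_bot_iff]
    rintro f ⟨hf, hf'⟩
    exact eq_zero_of_mem_kernelSpan M hf hf'.1
  rw [h1, h2, finrank_bot, add_zero] at h
  rw [h]
  push_cast
  ring

/-- The class of a polynomial in the quotient module. -/
noncomputable def polyClass : MvPolynomial (Fin n) ℂ →ₗ[ℂ] quotientModule M :=
  (quotientModule M).orthogonalProjectionOnto.toLinearMap ∘ₗ polyToDruryArveson n

theorem polyClass_apply (f : MvPolynomial (Fin n) ℂ) : polyClass M f =
    (quotientModule M).orthogonalProjectionOnto (polyToDruryArveson n f) := rfl

theorem coe_polyClass {k : ℕ} {h : MvPolynomial (Fin n) ℂ} (hh : h ∈ kernelSpan M k) :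
    (polyClass M h : DruryArveson n) = polyToDruryArveson n h :=
  Submodule.starProjection_eq_self_iff.mpr (polyToDruryArveson_mem_quotientModule M hh)

theorem polyClass_eq_zero {f : MvPolynomial (Fin n) ℂ} (hf : f ∈ homogeneousIdeal M) :
    polyClass M f = 0 := by
  rw [polyClass_apply, Submodule.orthogonalProjectionOnto_eq_zero_iff]
  exact Submodule.le_orthogonal_orthogonal _ ⟨f, hf, rfl⟩

theorem polyClass_congr {f g : MvPolynomial (Fin n) ℂ} (h : f - g ∈ homogeneousIdeal M) :
    polyClass M f = polyClass M g := by
  rw [← sub_eq_zero, ← map_sub]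
  exact polyClass_eq_zero M h

theorem polyClass_denseRange : DenseRange (polyClass M) := by
  have hs : Function.Surjective (quotientModule M).orthogonalProjectionOnto := fun x =>
    ⟨x, Submodule.orthogonalProjectionOnto_mem_subspace_eq_self x⟩
  exact hs.denseRange.comp (polyToDruryArveson_denseRange n)
    (quotientModule M).orthogonalProjectionOnto.continuous

/-- Operators on the quotient module are determined by their values on the kernels. -/
theorem clm_ext_of_kernelSpan {E : Type*} [NormedAddCommGroup E] [NormedSpace ℂ E]
    {S T : quotientModule M →L[ℂ] E}
    (h : ∀ k, ∀ f ∈ kernelSpan M k, S (polyClass M f) = T (polyClass M f)) : S = T := by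
  refine ContinuousLinearMap.coeFn_injective
    ((polyClass_denseRange M).equalizer S.continuous T.continuous (funext fun f => ?_))
  simp only [Function.comp_apply]
  rw [← sum_homogeneousComponent f, map_sum, map_sum, map_sum]
  refine Finset.sum_congr rfl fun k _ => ?_
  obtain ⟨g, hg, hfg⟩ :=
    exists_sub_mem_of_isHomogeneous M (homogeneousComponent_isHomogeneous k f)
  rw [polyClass_congr M hfg]
  exact h k g hg

theorem compressedShift_polyClass (α : Fin n) (f : MvPolynomial (Fin n) ℂ) :
    compressedShift M α (polyClass M f) = polyClass M (X α * f) := by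
  have H : ∀ k, ∀ g ∈ kernelSpan M k,
      compressedShift M α (polyClass M g) = polyClass M (X α * g) := by
    intro k g hg
    change (quotientModule M).orthogonalProjectionOnto
      (druryArvesonShift α (polyClass M g : DruryArveson n)) = _
    rw [coe_polyClass M hg, druryArvesonShift_polyToDruryArveson, polyClass_apply]
  rw [← sum_homogeneousComponent f, Finset.mul_sum, map_sum, map_sum, map_sum]
  refine Finset.sum_congr rfl fun k _ => ?_
  obtain ⟨g, hg, hfg⟩ :=
    exists_sub_mem_of_isHomogeneous M (homogeneousComponent_isHomogeneous k f)
  rw [polyClass_congr M hfg, H k g hg]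
  refine (polyClass_congr M ?_).symm
  rw [← mul_sub]
  exact Ideal.mul_mem_left _ _ hfg

theorem compressedShift_commute (α β : Fin n) :
    compressedShift M α ∘L compressedShift M β = compressedShift M β ∘L compressedShift M α := by
  refine clm_ext_of_kernelSpan M fun k f _ => ?_
  simp only [ContinuousLinearMap.comp_apply, compressedShift_polyClass]
  rw [mul_left_comm]

theorem inner_polyClass {k l : ℕ} {f g : MvPolynomial (Fin n) ℂ} (hf : f ∈ kernelSpan M k)
    (hg : g ∈ kernelSpan M l) : inner ℂ (polyClass M f) (polyClass M g) =
      inner ℂ (polyToDruryArveson n f) (polyToDruryArveson n g) := by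
  rw [Submodule.coe_inner, coe_polyClass M hf, coe_polyClass M hg]

theorem exists_polyClass_X_mul {k : ℕ} {f : MvPolynomial (Fin n) ℂ} (hf : f ∈ kernelSpan M k)
    (α : Fin n) : ∃ g ∈ kernelSpan M (k + 1), X α * f - g ∈ homogeneousIdeal M := by
  refine exists_sub_mem_of_isHomogeneous M ?_
  rw [add_comm]
  exact (isHomogeneous_X ℂ α).mul (kernelSpan_le M k hf)

/-- The defect operators act by scalars on the graded pieces if `∑ S_α^* S_α` does. -/
theorem tupleDefect_polyClass (c : ℕ → ℂ) (hc : ∀ k, c k ≠ 0)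
    (hS : ∀ k, ∀ f ∈ kernelSpan M k, ∑ α, ContinuousLinearMap.adjoint (compressedShift M α)
      (compressedShift M α (polyClass M f)) = (c k / c (k + 1)) • polyClass M f)
    (q k : ℕ) {f : MvPolynomial (Fin n) ℂ} (hf : f ∈ kernelSpan M k) :
    tupleDefect (fun α => compressedShift M α) q (polyClass M f) =
      (c k * (fun (u : ℕ → ℂ) k => u k - u (k + 1))^[q] (fun k => (c k)⁻¹) k) • polyClass M f := by
  induction q generalizing k f with
  | zero => simp [tupleDefect, hc k]
  | succ q ih =>
    have e : tupleDefect (fun α => compressedShift M α) (q + 1) =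
        tupleDefect (fun α => compressedShift M α) q -
          tuplePhi (fun α => compressedShift M α)
            (tupleDefect (fun α => compressedShift M α) q) := by
      rw [tupleDefect, Function.iterate_succ_apply']
      rfl
    rw [e, sub_apply, ih k hf, tuplePhi, sum_apply,
      Function.iterate_succ_apply']
    -- The shifts raise the degree by one, so `Φ_*` multiplies the scalar `c (k + 1) * v (k + 1)` by
    -- `c k / c (k + 1)`. What remains is `c k * (v k - v (k + 1))`.
    set v : ℕ → ℂ := (fun (u : ℕ → ℂ) k => u k - u (k + 1))^[q] (fun k => (c k)⁻¹) with hv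
    have h1 : ∀ α, (ContinuousLinearMap.adjoint (compressedShift M α) ∘L
        tupleDefect (fun α => compressedShift M α) q ∘L compressedShift M α) (polyClass M f) =
        (c (k + 1) * v (k + 1)) • ContinuousLinearMap.adjoint (compressedShift M α)
          (compressedShift M α (polyClass M f)) := by
      intro α
      obtain ⟨g, hg, hfg⟩ := exists_polyClass_X_mul M hf α
      simp only [ContinuousLinearMap.comp_apply]
      rw [compressedShift_polyClass, polyClass_congr M hfg, ih (k + 1) hg, map_smul]
    rw [Finset.sum_congr rfl fun α _ => h1 α, ← Finset.smul_sum, hS k f hf, smul_smul, ← sub_smul]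
    congr 1
    have := hc (k + 1)
    field_simp

end QuotientModule

/-! ### Vanishing of high differences and the isometry criterion. -/

theorem iterate_sub_shift_eq_zero (Q : Polynomial ℝ) (u : ℕ → ℂ) (d : ℕ) (hQ : Q.natDegree ≤ d)
    (hu : ∀ k, u k = (Q.eval (k : ℝ) : ℝ)) (k : ℕ) :
    (fun (u : ℕ → ℂ) k => u k - u (k + 1))^[d + 1] u k = 0 := by
  -- Up to sign these are forward differences of `Q`, and the order `d + 1` exceeds its degree.
  have H : ∀ q k, (fun (u : ℕ → ℂ) k => u k - u (k + 1))^[q] u k =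
      (((-1) ^ q * (fwdDiff (1 : ℝ))^[q] Q.eval (k : ℝ) : ℝ) : ℂ) := by
    intro q
    induction q with
    | zero => intro k; simp [hu]
    | succ q ih =>
      intro k
      rw [Function.iterate_succ_apply', Function.iterate_succ_apply', ih, ih,
        ← Complex.ofReal_sub, fwdDiff]
      congr 1
      push_cast
      ring
  rw [H, Polynomial.fwdDiff_iter_eq_zero_of_degree_lt (by omega)]
  simp

/-- A criterion for the compressed shift to be a `(d + 1)`-isometry. -/
theorem isQIsometry_of_reciprocal_polynomial {n d : ℕ} (M : Set (ℙ ℂ (Fin n → ℂ))) (c : ℕ → ℂ)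
    (hS : ∀ k, ∀ f ∈ kernelSpan M k, ∑ α, ContinuousLinearMap.adjoint (compressedShift M α)
      (compressedShift M α (polyClass M f)) = (c k / c (k + 1)) • polyClass M f)
    (hc : ∀ k, c k ≠ 0) (Q : Polynomial ℝ) (hQ : Q.natDegree ≤ d)
    (hcQ : ∀ k, (c k)⁻¹ = (Q.eval (k : ℝ) : ℝ)) :
    IsQIsometry (d + 1) (fun α : Fin n => compressedShift M α) := by
  refine ⟨compressedShift_commute M, clm_ext_of_kernelSpan M fun k f hf => ?_⟩
  rw [tupleDefect_polyClass M c hc hS (d + 1) k hf, iterate_sub_shift_eq_zero Q _ d hQ hcQ]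
  simp

open MeasureTheory

/-! ### The quotient module as a Hardy space -/

section Hardy

theorem star_dotProduct_star_eq {n : ℕ} (u z : Fin n → ℂ) :
    star (u ⬝ᵥ star z) = z ⬝ᵥ star u := by
  simp [dotProduct, mul_comm]

/-- Cauchy–Schwarz, applied to the degree one kernels in the Drury–Arveson space. -/
theorem norm_dotProduct_star_le_one {n : ℕ} {u v : Fin n → ℂ} (hu : u ⬝ᵥ star u = 1)
    (hv : v ⬝ᵥ star v = 1) : ‖u ⬝ᵥ star v‖ ≤ 1 := by
  have hi : ∀ z w : Fin n → ℂ, inner ℂ (polyToDruryArveson n (kernelPoly 1 z))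
      (polyToDruryArveson n (kernelPoly 1 w)) = z ⬝ᵥ star w := fun z w => by
    rw [inner_polyToDruryArveson_kernelPoly,
      homogeneousComponent_eq_self (kernelPoly_isHomogeneous 1 w), eval_kernelPoly, pow_one]
  have hn : ∀ z : Fin n → ℂ, z ⬝ᵥ star z = 1 → ‖polyToDruryArveson n (kernelPoly 1 z)‖ = 1 := by
    intro z hz
    rw [norm_eq_sqrt_re_inner (𝕜 := ℂ), hi, hz]
    simp
  rw [← hi]
  refine (norm_inner_le_norm _ _).trans ?_
  rw [hn u hu, hn v hv, one_mul]

theorem continuous_eval_comp {n : ℕ} {K : Type*} [TopologicalSpace K] {u : K → Fin n → ℂ}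
    (hu : Continuous u) (f : MvPolynomial (Fin n) ℂ) : Continuous fun x => eval (u x) f :=
  (MvPolynomial.continuous_eval f).comp hu

variable {n : ℕ} {M : Set (ℙ ℂ (Fin n → ℂ))} {K : Type*} [TopologicalSpace K] [CompactSpace K]
  [MeasurableSpace K] [BorelSpace K] {μ : Measure K} [IsProbabilityMeasure μ]
  {u : K → Fin n → ℂ} {c : ℕ → ℂ}

theorem integrable_eval_mul_star_eval (hu : Continuous u) (f g : MvPolynomial (Fin n) ℂ) :
    Integrable (fun x => eval (u x) f * star (eval (u x) g)) μ :=
  ((continuous_eval_comp hu f).mul (continuous_eval_comp hu g).star).integrable_of_hasCompactSupport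
    (HasCompactSupport.of_compactSpace _)

variable (μ) in
/-- The inner product of `L²` computes the Drury–Arveson inner product on each graded piece if it
does so on kernels. -/
theorem integral_eval_mul_star_eval (hu : Continuous u)
    (hE : ∀ k, ∀ z ∈ puncturedCone M, ∀ w ∈ puncturedCone M,
      ∫ x, (u x ⬝ᵥ star w) ^ k * (z ⬝ᵥ star (u x)) ^ k ∂μ = c k * (z ⬝ᵥ star w) ^ k)
    {k : ℕ} {f g : MvPolynomial (Fin n) ℂ} (hf : f ∈ kernelSpan M k) (hg : g ∈ kernelSpan M k) :
    ∫ x, eval (u x) f * star (eval (u x) g) ∂μ =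
      c k * inner ℂ (polyToDruryArveson n g) (polyToDruryArveson n f) := by
  induction hf using Submodule.span_induction with
  | zero => simp
  | add f₁ f₂ _ _ h₁ h₂ =>
    simp only [map_add, add_mul, inner_add_right, mul_add]
    rw [integral_add (integrable_eval_mul_star_eval hu _ _)
      (integrable_eval_mul_star_eval hu _ _), h₁, h₂]
  | smul a f _ h =>
    simp only [map_smul, smul_eval, inner_smul_right, mul_assoc]
    rw [integral_const_mul, h]
    ring
  | mem f hf =>
    obtain ⟨w, hw, rfl⟩ := hf
    induction hg using Submodule.span_induction with
    | zero => simp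
    | add g₁ g₂ _ _ h₁ h₂ =>
      simp only [map_add, star_add, mul_add, inner_add_left]
      rw [integral_add (integrable_eval_mul_star_eval hu _ _)
        (integrable_eval_mul_star_eval hu _ _), h₁, h₂]
    | smul a g _ h =>
      simp only [map_smul, smul_eval, inner_smul_left, star_mul', mul_left_comm _ (star a)]
      rw [integral_const_mul, h]
      simp only [RCLike.star_def]
      ring
    | mem g hg =>
      obtain ⟨z, hz, rfl⟩ := hg
      rw [inner_polyToDruryArveson_kernelPoly,
        homogeneousComponent_eq_self (kernelPoly_isHomogeneous k w), eval_kernelPoly,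
        ← hE k z hz w hw]
      refine integral_congr_ae (Filter.Eventually.of_forall fun x => ?_)
      simp only [eval_kernelPoly, star_pow]
      rw [star_dotProduct_star_eq]

/-- Since `∑ |u_α|² = 1`, summing the `L²` inner products of `u_α g` and `u_α f` over `α` gives back
that of `g` and `f`. The former is `c (k + 1)` times, the latter `c k` times, the Drury–Arveson
quantity. Different degrees are orthogonal. -/
theorem sum_adjoint_compressedShift (hu : Continuous u) (huM : ∀ x, u x ∈ puncturedCone M)
    (hu1 : ∀ x, u x ⬝ᵥ star (u x) = 1)
    (hE : ∀ k, ∀ z ∈ puncturedCone M, ∀ w ∈ puncturedCone M,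
      ∫ x, (u x ⬝ᵥ star w) ^ k * (z ⬝ᵥ star (u x)) ^ k ∂μ = c k * (z ⬝ᵥ star w) ^ k)
    (hc : ∀ k, c k ≠ 0) (hcr : ∀ k, star (c k) = c k)
    (k : ℕ) {f : MvPolynomial (Fin n) ℂ} (hf : f ∈ kernelSpan M k) :
    ∑ α, ContinuousLinearMap.adjoint (compressedShift M α)
      (compressedShift M α (polyClass M f)) = (c k / c (k + 1)) • polyClass M f := by
  rw [← sub_eq_zero, ← inner_self_eq_zero (𝕜 := ℂ)]
  set y := ∑ α, ContinuousLinearMap.adjoint (compressedShift M α)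
      (compressedShift M α (polyClass M f)) - (c k / c (k + 1)) • polyClass M f with hy
  suffices H : innerSL ℂ y = 0 by
    have := congrArg (fun T => T y) H
    simpa using this
  refine clm_ext_of_kernelSpan M fun l g hg => ?_
  rw [innerSL_apply_apply, zero_apply, hy, inner_sub_left, sum_inner,
    sub_eq_zero, inner_smul_left (E := quotientModule M)]
  simp only [ContinuousLinearMap.adjoint_inner_left, compressedShift_polyClass]
  choose f' hf' hff' using fun α => exists_polyClass_X_mul M hf α
  choose g' hg' hgg' using fun α => exists_polyClass_X_mul M hg α
  have e1 : ∀ α, inner ℂ (polyClass M (X α * f)) (polyClass M (X α * g)) =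
      inner ℂ (polyToDruryArveson n (f' α)) (polyToDruryArveson n (g' α)) := fun α => by
    rw [polyClass_congr M (hff' α), polyClass_congr M (hgg' α), inner_polyClass M (hf' α) (hg' α)]
  simp only [e1]
  rw [inner_polyClass M hf hg]
  by_cases hkl : k = l
  · subst hkl
    -- `X α * f` and its representative `f' α` differ by an element of the ideal, which vanishes at
    -- `u x`.
    have e2 : ∀ α x, eval (u x) (g' α) * star (eval (u x) (f' α)) =
        (u x α * star (u x α)) * (eval (u x) g * star (eval (u x) f)) := by
      intro α x
      have h1 := (mem_homogeneousIdeal M).mp (hff' α) _ (huM x)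
      have h2 := (mem_homogeneousIdeal M).mp (hgg' α) _ (huM x)
      rw [map_sub, sub_eq_zero, map_mul, eval_X] at h1 h2
      rw [← h1, ← h2, star_mul']
      ring
    have e3 : ∑ α, ∫ x, eval (u x) (g' α) * star (eval (u x) (f' α)) ∂μ =
        ∫ x, eval (u x) g * star (eval (u x) f) ∂μ := by
      rw [← integral_finsetSum _ fun α _ => integrable_eval_mul_star_eval hu _ _]
      refine integral_congr_ae (Filter.Eventually.of_forall fun x => ?_)
      simp only [e2]
      rw [← Finset.sum_mul]
      have h1 : ∑ α, u x α * star (u x α) = 1 := hu1 x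
      rw [h1, one_mul]
    rw [integral_eval_mul_star_eval μ hu hE hg hf, Finset.sum_congr rfl fun α _ =>
      integral_eval_mul_star_eval μ hu hE (hg' α) (hf' α), ← Finset.mul_sum] at e3
    have h2 := hc (k + 1)
    have h3 : (starRingEnd ℂ) (c k / c (k + 1)) = c k / c (k + 1) := by
      rw [map_div₀]
      exact congrArg₂ _ (hcr k) (hcr (k + 1))
    rw [h3]
    field_simp
    linear_combination e3
  · rw [inner_polyToDruryArveson_of_ne hkl (kernelSpan_le M k hf) (kernelSpan_le M l hg), mul_zero]
    exact Finset.sum_eq_zero fun α _ => inner_polyToDruryArveson_of_ne (by omega)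
      (kernelSpan_le M _ (hf' α)) (kernelSpan_le M _ (hg' α))

/-- For an orthonormal basis `f_j` in degree `k`, Parseval applied to the kernel at `u x` gives `∑
|f_j (u x)|² = ‖u x‖^(2k) = 1`. Each summand integrates to `c k`. -/
theorem mul_finrank_kernelSpan_eq_one (hu : Continuous u) (huM : ∀ x, u x ∈ puncturedCone M)
    (hu1 : ∀ x, u x ⬝ᵥ star (u x) = 1)
    (hE : ∀ k, ∀ z ∈ puncturedCone M, ∀ w ∈ puncturedCone M,
      ∫ x, (u x ⬝ᵥ star w) ^ k * (z ⬝ᵥ star (u x)) ^ k ∂μ = c k * (z ⬝ᵥ star w) ^ k)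
    (k : ℕ) : c k * Module.finrank ℂ (kernelSpan M k) = 1 := by
  let V : Submodule ℂ (DruryArveson n) := (kernelSpan M k).map (polyToDruryArveson n)
  have hV : Module.finrank ℂ V = Module.finrank ℂ (kernelSpan M k) :=
    (Submodule.equivMapOfInjective _ (polyToDruryArveson_injective n) _).finrank_eq.symm
  let b := stdOrthonormalBasis ℂ V
  choose f hf hfb using fun j => (b j).2
  have e1 : ∀ x, ∑ j, eval (u x) (f j) * star (eval (u x) (f j)) = 1 := by
    intro x
    let κ : V := ⟨polyToDruryArveson n (kernelPoly k (u x)),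
      ⟨_, Submodule.subset_span ⟨u x, huM x, rfl⟩, rfl⟩⟩
    have h1 : ∀ j, eval (u x) (f j) = inner ℂ κ (b j) := fun j => by
      rw [Submodule.coe_inner, ← hfb j, inner_polyToDruryArveson_kernelPoly,
        homogeneousComponent_eq_self (kernelSpan_le M k (hf j))]
    have h2 : ∀ j, star (eval (u x) (f j)) = inner ℂ (b j) κ := fun j => by
      rw [h1]
      exact inner_conj_symm (𝕜 := ℂ) (b j) κ
    rw [Finset.sum_congr rfl fun j _ => congrArg₂ _ (h1 j) (h2 j), b.sum_inner_mul_inner,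
      Submodule.coe_inner,
      inner_polyToDruryArveson_kernelPoly,
      homogeneousComponent_eq_self (kernelPoly_isHomogeneous k (u x)), eval_kernelPoly, hu1,
      one_pow]
  have e2 : ∑ j, ∫ x, eval (u x) (f j) * star (eval (u x) (f j)) ∂μ = 1 := by
    rw [← integral_finsetSum _ fun j _ => integrable_eval_mul_star_eval hu _ _]
    simp only [e1]
    simp
  have e3 : ∀ j, ∫ x, eval (u x) (f j) * star (eval (u x) (f j)) ∂μ = c k := fun j => by
    rw [integral_eval_mul_star_eval μ hu hE (hf j) (hf j), hfb j, ← Submodule.coe_inner,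
      inner_self_eq_norm_sq_to_K, b.orthonormal.1 j]
    simp
  simp only [e3] at e2
  rw [Finset.sum_const, Finset.card_univ, Fintype.card_fin, hV, nsmul_eq_mul] at e2
  rw [mul_comm]
  exact e2

-- Here the Hilbert polynomial meets the moments: `1 / c k` is the Hilbert function, polynomial for
-- large `k`, and `c k` is the `k`-th moment of `|⟨u, v⟩|²`. Extrapolation extends the identity to
-- all `k`.
variable (μ) in
theorem isQIsometry_of_integral_kernel {d : ℕ} (hd : HasComplexDim M d)
    (hu : Continuous u) (huM : ∀ x, u x ∈ puncturedCone M)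
    (hu1 : ∀ x, u x ⬝ᵥ star (u x) = 1)
    {v : Fin n → ℂ} (hv : v ∈ puncturedCone M) (hv1 : v ⬝ᵥ star v = 1)
    (hE : ∀ k, ∀ z ∈ puncturedCone M, ∀ w ∈ puncturedCone M,
      ∫ x, (u x ⬝ᵥ star w) ^ k * (z ⬝ᵥ star (u x)) ^ k ∂μ = c k * (z ⬝ᵥ star w) ^ k)
    (h0 : ∀ᵐ x ∂μ, u x ⬝ᵥ star v ≠ 0) :
    IsQIsometry (d + 1) (fun α : Fin n => compressedShift M α) := by
  let t : K → ℝ := fun x => ‖u x ⬝ᵥ star v‖ ^ 2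
  have ht : Continuous t := by
    have : Continuous fun x => u x ⬝ᵥ star v := hu.dotProduct continuous_const
    exact this.norm.pow 2
  have hct : ∀ k, c k = ((∫ x, t x ^ k ∂μ : ℝ) : ℂ) := by
    intro k
    have h := hE k v hv v hv
    rw [hv1, one_pow, mul_one] at h
    rw [← h, ← integral_complex_ofReal]
    refine integral_congr_ae (Filter.Eventually.of_forall fun x => ?_)
    simp only [t]
    rw [← star_dotProduct_star_eq (u x) v, ← mul_pow, Complex.ofReal_pow]
    congr 1
    rw [RCLike.star_def, Complex.mul_conj, Complex.normSq_eq_norm_sq]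
  have hfin := mul_finrank_kernelSpan_eq_one hu huM hu1 hE
  have hc : ∀ k, c k ≠ 0 := fun k hk => by
    have := hfin k
    rw [hk, zero_mul] at this
    exact zero_ne_one this
  obtain ⟨Q, k₀, hQ⟩ := exists_hilbertPolynomial (homogeneousIdeal M)
    (containsComponents_homogeneousIdeal M)
  let P : Polynomial ℝ := Q.map (algebraMap ℚ ℝ)
  have hP : ∀ k ≥ k₀, (Module.finrank ℂ (kernelSpan M k) : ℝ) = P.eval (k : ℝ) := by
    intro k hk
    have h := hQ k hk
    rw [← finrank_kernelSpan] at h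
    have h1 := Polynomial.eval_map_algebraMap Q (k : ℝ)
    rw [h1, ← map_natCast (algebraMap ℚ ℝ) k, Polynomial.aeval_algebraMap_apply_eq_algebraMap_eval,
      ← h]
    simp
  have hdeg : P.natDegree ≤ d := natDegree_hilbertPolynomial_le
    (containsComponents_homogeneousIdeal M) hd (kernelSpan M) (kernelSpan_le M)
    (fun k f hf hfI => eq_zero_of_mem_kernelSpan M hf hfI) P k₀ hP
  have hmom : ∀ k : ℕ, P.eval (k : ℝ) * ∫ x, t x ^ k ∂μ = 1 := by
    refine eval_mul_integral_pow_eq_one μ ht.measurable ?_ ?_ P k₀ fun k hk => ?_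
    · filter_upwards [h0] with x hx
      exact pow_pos (norm_pos_iff.mpr hx) 2
    · exact Filter.Eventually.of_forall fun x =>
        pow_le_one₀ (norm_nonneg _) (norm_dotProduct_star_le_one (hu1 x) hv1)
    · rw [← hP k hk]
      have h := hfin k
      rw [hct, mul_comm] at h
      exact_mod_cast h
  refine isQIsometry_of_reciprocal_polynomial M c (fun k f hf =>
    sum_adjoint_compressedShift hu huM hu1 hE hc (fun k => ?_) k hf) hc P hdeg fun k => ?_
  · rw [hct]
    exact Complex.conj_ofReal _
  · rw [hct, ← Complex.ofReal_inv]
    congr 1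
    exact (eq_inv_of_mul_eq_one_left (hmom k)).symm

end Hardy

/-! ### Polarization of sesquiholomorphic polynomials on an affine variety -/

namespace MvPolynomial

theorem aeval_self_apply {σ F : Type*} [Field F] (z : σ → F) (f : MvPolynomial σ F) :
    aeval z f = eval z f := by
  rw [← coe_aeval_eq_eval]
  rfl

theorem eval_star_eq_star_eval_map {σ : Type*} (f : MvPolynomial σ ℂ) (w : σ → ℂ) :
    eval (star w) (map (starRingEnd ℂ) f) = star (eval w f) := by
  induction f using MvPolynomial.induction_on with
  | C a => simp
  | add p q hp hq => simp only [map_add, hp, hq, star_add]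
  | mul_X p i hp => simp only [map_mul, map_X, eval_X, hp, star_mul', Pi.star_apply]

/-- A polynomial that vanishes on all pairs `(y, star y)` is zero. -/
theorem eq_zero_of_eval_elim_star {σ : Type*} [Finite σ] (a : MvPolynomial (σ ⊕ σ) ℂ)
    (h : ∀ y : σ → ℂ, eval (Sum.elim y (star y)) a = 0) : a = 0 := by
  -- The invertible substitution `(p + iq, p - iq)` sends real `(p, q)` to pairs `(y, star y)`, and
  -- real points are Zariski dense.
  let b : MvPolynomial (σ ⊕ σ) ℂ := aeval (Sum.elim
    (fun i => X (Sum.inl i) + C Complex.I * X (Sum.inr i))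
    (fun i => X (Sum.inl i) - C Complex.I * X (Sum.inr i))) a
  have heval : ∀ x : σ ⊕ σ → ℂ, eval x b = eval (Sum.elim
      (fun i => x (Sum.inl i) + Complex.I * x (Sum.inr i))
      (fun i => x (Sum.inl i) - Complex.I * x (Sum.inr i))) a := by
    intro x
    simp only [b]
    rw [aeval_def, ← coe_eval₂Hom, ← RingHom.comp_apply]
    congr 1
    refine MvPolynomial.ringHom_ext (fun r => by simp) fun i => ?_
    cases i <;> simp
  have hb : b = 0 := by
    refine MvPolynomial.funext_set (fun _ => Set.range ((↑) : ℝ → ℂ))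
      (fun _ => Set.infinite_range_of_injective Complex.ofReal_injective) fun x hx => ?_
    rw [map_zero, heval, ← h (fun i => x (Sum.inl i) + Complex.I * x (Sum.inr i))]
    congr 2
    funext i
    cases i with
    | inl i => rfl
    | inr i =>
      obtain ⟨p, hp⟩ := hx (Sum.inl i) trivial
      obtain ⟨q, hq⟩ := hx (Sum.inr i) trivial
      simp only [Sum.elim_inr, Pi.star_apply, star_add, star_mul', ← hp, ← hq, RCLike.star_def,
        Complex.conj_I, Complex.conj_ofReal]
      ring
  refine MvPolynomial.funext fun x => ?_
  rw [map_zero]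
  have h1 := heval (Sum.elim (fun i => (x (Sum.inl i) + x (Sum.inr i)) / 2)
    (fun i => (x (Sum.inl i) - x (Sum.inr i)) / (2 * Complex.I)))
  rw [hb, map_zero] at h1
  rw [h1]
  congr 2
  have hI := Complex.I_ne_zero
  funext i
  cases i <;>
  · simp only [Sum.elim_inl, Sum.elim_inr]
    field_simp
    ring

variable {n : ℕ}

/-- The pairs `(z, star w)` of points of the zero locus of an ideal. -/
def conjPairs (I : Ideal (MvPolynomial (Fin n) ℂ)) : Set (Fin n ⊕ Fin n → ℂ) :=
  {x | ∃ z ∈ zeroLocus ℂ I, ∃ w ∈ zeroLocus ℂ I, x = Sum.elim z (star w)}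

theorem mem_vanishingIdeal_conjPairs {I : Ideal (MvPolynomial (Fin n) ℂ)}
    {F : MvPolynomial (Fin n ⊕ Fin n) ℂ} : F ∈ vanishingIdeal ℂ (conjPairs I) ↔
      ∀ z ∈ zeroLocus ℂ I, ∀ w ∈ zeroLocus ℂ I, eval (Sum.elim z (star w)) F = 0 := by
  rw [mem_vanishingIdeal_iff]
  constructor
  · intro h z hz w hw
    have := h _ ⟨z, hz, w, hw, rfl⟩
    rwa [aeval_self_apply] at this
  · rintro h _ ⟨z, hz, w, hw, rfl⟩
    rw [aeval_self_apply]
    exact h z hz w hw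

theorem mem_of_isPrime_iff {I : Ideal (MvPolynomial (Fin n) ℂ)} [I.IsPrime]
    {f : MvPolynomial (Fin n) ℂ} : f ∈ I ↔ ∀ z ∈ zeroLocus ℂ I, eval z f = 0 := by
  conv_lhs => rw [← IsPrime.vanishingIdeal_zeroLocus (K := ℂ) I]
  simp only [mem_vanishingIdeal_iff, aeval_self_apply]

/-- A product of irreducible varieties is irreducible. If `F G` vanishes on all pairs, then for
fixed `z` one of the slices `F(z, ·)`, `G(z, ·)` vanishes, whence `F(z, w₁) G(z, w₂) = 0`. Primality
in `z` then makes one of these two factors vanish identically. Slices in `w` are antiholomorphic and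
are conjugated to become polynomials. -/
theorem isPrime_vanishingIdeal_conjPairs (I : Ideal (MvPolynomial (Fin n) ℂ)) [hI : I.IsPrime] :
    (vanishingIdeal ℂ (conjPairs I)).IsPrime := by
  have hfst : ∀ (F : MvPolynomial (Fin n ⊕ Fin n) ℂ) (w : Fin n → ℂ),
      ∃ f : MvPolynomial (Fin n) ℂ, ∀ z, eval z f = eval (Sum.elim z (star w)) F := by
    intro F w
    refine ⟨aeval (Sum.elim X (fun i => C (star (w i)))) F, fun z => ?_⟩
    rw [aeval_def, ← coe_eval₂Hom, ← RingHom.comp_apply]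
    congr 1
    refine MvPolynomial.ringHom_ext (fun r => by simp) fun i => ?_
    cases i <;> simp
  have hsnd : ∀ (F : MvPolynomial (Fin n ⊕ Fin n) ℂ) (z : Fin n → ℂ),
      ∃ f : MvPolynomial (Fin n) ℂ, ∀ w, eval w f = star (eval (Sum.elim z (star w)) F) := by
    intro F z
    refine ⟨map (starRingEnd ℂ) (aeval (Sum.elim (fun i => C (z i)) X) F), fun w => ?_⟩
    rw [← star_star w, eval_star_eq_star_eval_map, star_star]
    congr 1
    rw [aeval_def, ← coe_eval₂Hom, ← RingHom.comp_apply]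
    congr 1
    refine MvPolynomial.ringHom_ext (fun r => by simp) fun i => ?_
    cases i <;> simp
  refine ⟨?_, fun {F G} hFG => ?_⟩
  · rw [Ideal.ne_top_iff_one, mem_vanishingIdeal_conjPairs]
    intro h
    refine hI.ne_top ((Ideal.eq_top_iff_one I).mpr (mem_of_isPrime_iff.mpr fun z hz => ?_))
    simpa using h z hz z hz
  · rw [mem_vanishingIdeal_conjPairs] at hFG
    simp only [mem_vanishingIdeal_conjPairs]
    by_contra! hcon
    obtain ⟨⟨z₁, hz₁, w₁, hw₁, h₁⟩, z₂, hz₂, w₂, hw₂, h₂⟩ := hcon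
    obtain ⟨f, hf⟩ := hfst F w₁
    obtain ⟨g, hg⟩ := hfst G w₂
    have hfg : f * g ∈ I := by
      refine mem_of_isPrime_iff.mpr fun z hz => ?_
      obtain ⟨p, hp⟩ := hsnd F z
      obtain ⟨q, hq⟩ := hsnd G z
      have hpq : p * q ∈ I := by
        refine mem_of_isPrime_iff.mpr fun w hw => ?_
        rw [map_mul, hp, hq, ← star_mul', ← map_mul, hFG z hz w hw, star_zero]
      rw [map_mul]
      rcases hI.mem_or_mem hpq with h | h
      · have := mem_of_isPrime_iff.mp h w₁ hw₁
        rw [hp, star_eq_zero] at this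
        rw [hf, this, zero_mul]
      · have := mem_of_isPrime_iff.mp h w₂ hw₂
        rw [hq, star_eq_zero] at this
        rw [hg, this, mul_zero]
    rcases hI.mem_or_mem hfg with h | h
    · exact h₁ ((hf z₁).symm.trans (mem_of_isPrime_iff.mp h z₁ hz₁))
    · exact h₂ ((hg z₂).symm.trans (mem_of_isPrime_iff.mp h z₂ hz₂))

/-- The points of an affine variety surject onto the points of its Noether normalization. -/
theorem exists_mem_zeroLocus_of_isIntegral {s : ℕ} {I : Ideal (MvPolynomial (Fin n) ℂ)}
    (g : MvPolynomial (Fin s) ℂ →ₐ[ℂ] MvPolynomial (Fin n) ℂ ⧸ I) (hinj : Function.Injective g)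
    (hint : g.toRingHom.IsIntegral) (y : Fin s → ℂ) :
    ∃ z ∈ zeroLocus ℂ I, ∀ i f, Ideal.Quotient.mk I f = g (X i) → eval z f = y i := by
  let _ : Algebra (MvPolynomial (Fin s) ℂ) (MvPolynomial (Fin n) ℂ ⧸ I) := g.toRingHom.toAlgebra
  have : Algebra.IsIntegral (MvPolynomial (Fin s) ℂ) (MvPolynomial (Fin n) ℂ ⧸ I) := ⟨hint⟩
  have hmax : (vanishingIdeal ℂ {y}).IsMaximal :=
    isMaximal_iff_eq_vanishingIdeal_singleton.mpr ⟨y, rfl⟩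
  -- A maximal ideal lying over that of `y` is, by the Nullstellensatz, the ideal of a point `z`.
  obtain ⟨N, hN, hNy⟩ := Ideal.exists_ideal_over_maximal_of_isIntegral
    (S := MvPolynomial (Fin n) ℂ ⧸ I) (vanishingIdeal ℂ {y}) (by
      change RingHom.ker g.toRingHom ≤ _
      rw [(RingHom.injective_iff_ker_eq_bot g.toRingHom).mp hinj]
      exact bot_le)
  have hN' : (N.comap (Ideal.Quotient.mk I)).IsMaximal :=
    Ideal.comap_isMaximal_of_surjective _ Ideal.Quotient.mk_surjective
  obtain ⟨z, hz⟩ := isMaximal_iff_eq_vanishingIdeal_singleton.mp hN'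
  have hmem : ∀ f, Ideal.Quotient.mk I f ∈ N ↔ eval z f = 0 := fun f => by
    rw [← Ideal.mem_comap, hz, mem_vanishingIdeal_singleton_iff, aeval_self_apply]
  refine ⟨z, fun f hf => ?_, fun i f hf => ?_⟩
  · rw [aeval_self_apply]
    refine (hmem f).mp ?_
    rw [Ideal.Quotient.eq_zero_iff_mem.mpr hf]
    exact N.zero_mem
  · have h1 : (X i - C (y i) : MvPolynomial (Fin s) ℂ) ∈ N.comap g.toRingHom := by
      change _ ∈ N.comap (algebraMap (MvPolynomial (Fin s) ℂ) (MvPolynomial (Fin n) ℂ ⧸ I))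
      rw [hNy, mem_vanishingIdeal_singleton_iff]
      simp
    have h2 : Ideal.Quotient.mk I (f - C (y i)) ∈ N := by
      rw [map_sub, hf]
      have h3 : g (C (y i)) = Ideal.Quotient.mk I (C (y i)) := g.commutes (y i)
      rw [← h3, ← map_sub]
      exact h1
    rw [hmem, map_sub, eval_C, sub_eq_zero] at h2
    exact h2

/-- A sesquiholomorphic polynomial that vanishes on the diagonal of an irreducible affine variety
vanishes on all pairs of points. -/
theorem eval_elim_star_eq_zero (I : Ideal (MvPolynomial (Fin n) ℂ)) [hI : I.IsPrime]
    (F : MvPolynomial (Fin n ⊕ Fin n) ℂ)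
    (hF : ∀ z ∈ zeroLocus ℂ I, eval (Sum.elim z (star z)) F = 0) :
    ∀ z ∈ zeroLocus ℂ I, ∀ w ∈ zeroLocus ℂ I, eval (Sum.elim z (star w)) F = 0 := by
  have hJ := isPrime_vanishingIdeal_conjPairs I
  rw [← mem_vanishingIdeal_conjPairs]
  set J := vanishingIdeal ℂ (conjPairs I) with hJdef
  by_contra hFJ
  -- A Noether normalization of the variety, taken twice, makes the coordinate ring of the pairs
  -- integral over `ℂ[y, y']`. That ring is a domain, so `F ∉ J` would have a multiple coming from a
  -- non-zero `a ∈ ℂ[y, y']`. Every `y` lifts to a point `z` of the variety, where `F (z, star z) =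
  -- 0`, so `a (y, star y) = 0` for all `y` and `a = 0`.
  obtain ⟨s, g, hinj, hint⟩ := exists_integral_inj_algHom_of_fg ℂ (MvPolynomial (Fin n) ℂ ⧸ I)
  let j₁ : MvPolynomial (Fin n) ℂ ⧸ I →+* MvPolynomial (Fin n ⊕ Fin n) ℂ ⧸ J :=
    Ideal.Quotient.lift I ((Ideal.Quotient.mk J).comp (rename Sum.inl).toRingHom) (fun f hf => by
      refine Ideal.Quotient.eq_zero_iff_mem.mpr (mem_vanishingIdeal_conjPairs.mpr ?_)
      intro z hz w hw
      change eval _ (rename Sum.inl f) = 0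
      rw [eval_rename, Sum.elim_comp_inl]
      exact mem_of_isPrime_iff.mp hf z hz)
  -- Coefficients are conjugated because the second set of variables stands for `star w`.
  let j₂ : MvPolynomial (Fin n) ℂ ⧸ I →+* MvPolynomial (Fin n ⊕ Fin n) ℂ ⧸ J :=
    Ideal.Quotient.lift I ((Ideal.Quotient.mk J).comp
      ((rename Sum.inr).toRingHom.comp (map (starRingEnd ℂ)))) (fun f hf => by
      refine Ideal.Quotient.eq_zero_iff_mem.mpr (mem_vanishingIdeal_conjPairs.mpr ?_)
      intro z hz w hw
      change eval _ (rename Sum.inr (map (starRingEnd ℂ) f)) = 0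
      rw [eval_rename, Sum.elim_comp_inr, eval_star_eq_star_eval_map,
        mem_of_isPrime_iff.mp hf w hw, star_zero])
  let φ : MvPolynomial (Fin s ⊕ Fin s) ℂ →+* MvPolynomial (Fin n ⊕ Fin n) ℂ ⧸ J :=
    eval₂Hom ((Ideal.Quotient.mk J).comp C)
      (Sum.elim (fun i => j₁ (g (X i))) (fun i => j₂ (g (X i))))
  have hgC : ∀ a, g (C a) = Ideal.Quotient.mk I (C a) := fun a => g.commutes a
  have hφ₁ : φ.comp (rename Sum.inl).toRingHom = j₁.comp g.toRingHom := by
    refine MvPolynomial.ringHom_ext (fun a => ?_) fun i => ?_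
    · change φ (rename Sum.inl (C a)) = j₁ (g (C a))
      simp [φ, hgC, j₁]
    · change φ (rename Sum.inl (X i)) = j₁ (g (X i))
      simp [φ]
  have hφ₂ : φ.comp ((rename Sum.inr).toRingHom.comp (map (starRingEnd ℂ))) =
      j₂.comp g.toRingHom := by
    refine MvPolynomial.ringHom_ext (fun a => ?_) fun i => ?_
    · change φ (rename Sum.inr (map (starRingEnd ℂ) (C a))) = j₂ (g (C a))
      simp [φ, hgC, j₂]
    · change φ (rename Sum.inr (map (starRingEnd ℂ) (X i))) = j₂ (g (X i))
      simp [φ]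
  have hint₁ : ∀ r, φ.IsIntegralElem (j₁ r) := fun r => by
    obtain ⟨p, hp, hpr⟩ := hint r
    refine ⟨p.map (rename Sum.inl).toRingHom, hp.map _, ?_⟩
    rw [Polynomial.eval₂_map, hφ₁, ← Polynomial.hom_eval₂]
    exact (congrArg j₁ hpr).trans (map_zero _)
  have hint₂ : ∀ r, φ.IsIntegralElem (j₂ r) := fun r => by
    obtain ⟨p, hp, hpr⟩ := hint r
    refine ⟨p.map ((rename Sum.inr).toRingHom.comp (map (starRingEnd ℂ))), hp.map _, ?_⟩
    rw [Polynomial.eval₂_map, hφ₂, ← Polynomial.hom_eval₂]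
    exact (congrArg j₂ hpr).trans (map_zero _)
  let _ : Algebra (MvPolynomial (Fin s ⊕ Fin s) ℂ) (MvPolynomial (Fin n ⊕ Fin n) ℂ ⧸ J) :=
    φ.toAlgebra
  have hintF : ∀ G : MvPolynomial (Fin n ⊕ Fin n) ℂ,
      IsIntegral (MvPolynomial (Fin s ⊕ Fin s) ℂ) (Ideal.Quotient.mk J G) := by
    intro G
    induction G using MvPolynomial.induction_on with
    | C a =>
      have : Ideal.Quotient.mk J (C a) = algebraMap (MvPolynomial (Fin s ⊕ Fin s) ℂ) _ (C a) := by
        change _ = φ (C a)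
        simp [φ]
      rw [this]
      exact isIntegral_algebraMap
    | add p q hp hq => rw [map_add]; exact hp.add hq
    | mul_X p i hp =>
      rw [map_mul]
      refine hp.mul ?_
      cases i with
      | inl i =>
        have : Ideal.Quotient.mk J (X (Sum.inl i)) = j₁ (Ideal.Quotient.mk I (X i)) := by simp [j₁]
        rw [this]
        exact hint₁ _
      | inr i =>
        have : Ideal.Quotient.mk J (X (Sum.inr i)) = j₂ (Ideal.Quotient.mk I (X i)) := by simp [j₂]
        rw [this]
        exact hint₂ _
  have hF0 : Ideal.Quotient.mk J F ≠ 0 := fun h => hFJ (Ideal.Quotient.eq_zero_iff_mem.mp h)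
  obtain ⟨a, ha, ha0⟩ := Submodule.exists_mem_ne_zero_of_ne_bot
    (Ideal.comap_ne_bot_of_integral_mem hF0 (Ideal.mem_span_singleton_self _) (hintF F))
  refine ha0 (eq_zero_of_eval_elim_star a fun y => ?_)
  obtain ⟨z, hz, hzy⟩ := exists_mem_zeroLocus_of_isIntegral g hinj hint y
  let ev : MvPolynomial (Fin n ⊕ Fin n) ℂ ⧸ J →+* ℂ :=
    Ideal.Quotient.lift J (eval (Sum.elim z (star z))) fun G hG =>
      mem_vanishingIdeal_conjPairs.mp hG z hz z hz
  have hev : ev.comp φ = eval (Sum.elim y (star y)) := by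
    refine MvPolynomial.ringHom_ext (fun a => by simp [φ, ev]) fun i => ?_
    cases i with
    | inl i =>
      obtain ⟨f, hf⟩ := Ideal.Quotient.mk_surjective (g (X i))
      simp [φ, ← hf, j₁, ev, eval_rename, hzy i f hf]
    | inr i =>
      obtain ⟨f, hf⟩ := Ideal.Quotient.mk_surjective (g (X i))
      have h := eval_star_eq_star_eval_map f z
      rw [hzy i f hf, eval_map] at h
      simpa [φ, ← hf, j₂, ev, eval_rename] using h
  rw [← hev, RingHom.comp_apply]
  obtain ⟨b, hb⟩ := Ideal.mem_span_singleton'.mp (Ideal.mem_comap.mp ha)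
  change ev (algebraMap (MvPolynomial (Fin s ⊕ Fin s) ℂ) _ a) = 0
  rw [← hb, map_mul]
  have : ev (Ideal.Quotient.mk J F) = 0 := by
    simp only [ev, Ideal.Quotient.lift_mk]
    exact hF z hz
  rw [this, mul_zero]

end MvPolynomial

/-! ### Irreducibility of homogeneous projective varieties -/

namespace MvPolynomial

variable {n : ℕ}

/-- The substitution of a linear map in a polynomial. -/
noncomputable def linearSubst (A : Matrix (Fin n) (Fin n) ℂ) :
    MvPolynomial (Fin n) ℂ →ₐ[ℂ] MvPolynomial (Fin n) ℂ :=
  aeval fun i => ∑ j, C (A i j) * X j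

theorem eval_linearSubst (A : Matrix (Fin n) (Fin n) ℂ) (f : MvPolynomial (Fin n) ℂ)
    (z : Fin n → ℂ) : eval z (linearSubst A f) = eval (A.mulVec z) f := by
  rw [linearSubst, aeval_def, ← coe_eval₂Hom, ← RingHom.comp_apply]
  congr 1
  refine MvPolynomial.ringHom_ext (fun r => by simp) fun i => ?_
  simp [Matrix.mulVec, dotProduct]

theorem linearSubst_linearSubst (A B : Matrix (Fin n) (Fin n) ℂ) (f : MvPolynomial (Fin n) ℂ) :
    linearSubst B (linearSubst A f) = linearSubst (A * B) f :=
  MvPolynomial.funext fun z => by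
    rw [eval_linearSubst, eval_linearSubst, eval_linearSubst, Matrix.mulVec_mulVec]

theorem linearSubst_one (f : MvPolynomial (Fin n) ℂ) : linearSubst 1 f = f :=
  MvPolynomial.funext fun z => by rw [eval_linearSubst, Matrix.one_mulVec]

/-- The translate of an ideal by a linear map. -/
noncomputable def idealTranslate (A : Matrix (Fin n) (Fin n) ℂ)
    (J : Ideal (MvPolynomial (Fin n) ℂ)) :
    Ideal (MvPolynomial (Fin n) ℂ) :=
  J.comap (linearSubst A)

theorem mem_idealTranslate {A : Matrix (Fin n) (Fin n) ℂ} {J : Ideal (MvPolynomial (Fin n) ℂ)}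
    {f : MvPolynomial (Fin n) ℂ} : f ∈ idealTranslate A J ↔ linearSubst A f ∈ J := Iff.rfl

theorem idealTranslate_idealTranslate (A B : Matrix (Fin n) (Fin n) ℂ)
    (J : Ideal (MvPolynomial (Fin n) ℂ)) :
    idealTranslate A (idealTranslate B J) = idealTranslate (A * B) J := by
  ext f
  rw [mem_idealTranslate, mem_idealTranslate, mem_idealTranslate, linearSubst_linearSubst]

theorem idealTranslate_one (J : Ideal (MvPolynomial (Fin n) ℂ)) : idealTranslate 1 J = J := by
  ext f
  rw [mem_idealTranslate, linearSubst_one]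

theorem idealTranslate_mono (A : Matrix (Fin n) (Fin n) ℂ) {J J' : Ideal (MvPolynomial (Fin n) ℂ)}
    (h : J ≤ J') : idealTranslate A J ≤ idealTranslate A J' :=
  Ideal.comap_mono h

theorem mulVec_mem_zeroLocus_idealTranslate {A B : Matrix (Fin n) (Fin n) ℂ} (hBA : B * A = 1)
    {J : Ideal (MvPolynomial (Fin n) ℂ)} {z : Fin n → ℂ} :
    A.mulVec z ∈ zeroLocus ℂ (idealTranslate A J) ↔ z ∈ zeroLocus ℂ J := by
  simp only [mem_zeroLocus_iff, mem_idealTranslate, aeval_self_apply]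
  constructor
  · intro h f hf
    have := h (linearSubst B f) (by rwa [linearSubst_linearSubst, hBA, linearSubst_one])
    rwa [eval_linearSubst, Matrix.mulVec_mulVec, hBA, Matrix.one_mulVec] at this
  · intro h f hf
    rw [← eval_linearSubst]
    exact h _ hf

theorem smul_mem_zeroLocus {J : Ideal (MvPolynomial (Fin n) ℂ)} (hJ : ContainsComponents J)
    {z : Fin n → ℂ} (hz : z ∈ zeroLocus ℂ J) (c : ℂ) : c • z ∈ zeroLocus ℂ J := by
  simp only [mem_zeroLocus_iff, aeval_self_apply] at hz ⊢
  intro f hf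
  rw [eval_smul_eq_sum]
  exact Finset.sum_eq_zero fun k _ => by rw [hz _ (hJ f hf k), mul_zero]

-- The homogeneous core of a prime is prime and still contains the homogeneous ideal `I`, so a
-- minimal prime equals its core.
attribute [local instance] MvPolynomial.gradedAlgebra in
theorem containsComponents_of_mem_minimalPrimes {I p : Ideal (MvPolynomial (Fin n) ℂ)}
    (hI : ContainsComponents I) (hp : p ∈ I.minimalPrimes) : ContainsComponents p := by
  have hprime : p.IsPrime := hp.1.1
  have hI' : I.IsHomogeneous (homogeneousSubmodule (Fin n) ℂ) := by
    intro k f hf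
    convert hI f hf k
    exact decomposition.decompose'_apply f k
  have hIp : I ≤ (p.homogeneousCore (homogeneousSubmodule (Fin n) ℂ)).toIdeal := by
    conv_lhs => rw [← hI'.toIdeal_homogeneousCore_eq_self]
    exact Ideal.homogeneousCore_mono _ hp.1.2
  have hle : p ≤ (p.homogeneousCore (homogeneousSubmodule (Fin n) ℂ)).toIdeal :=
    hp.2 ⟨hprime.homogeneousCore, hIp⟩ (Ideal.toIdeal_homogeneousCore_le _ p)
  have hph : p.IsHomogeneous (homogeneousSubmodule (Fin n) ℂ) := by
    rw [← le_antisymm (Ideal.toIdeal_homogeneousCore_le _ p) hle]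
    exact HomogeneousIdeal.isHomogeneous _
  exact fun f hf k => homogeneousComponent_mem_of_mem hph hf k

theorem isClosed_zeroLocus (J : Ideal (MvPolynomial (Fin n) ℂ)) : IsClosed (zeroLocus ℂ J) := by
  have : zeroLocus ℂ J = ⋂ f ∈ J, {z | eval z f = 0} := by
    ext z
    simp [mem_zeroLocus_iff]
  rw [this]
  exact isClosed_biInter fun f _ => isClosed_eq (MvPolynomial.continuous_eval f) continuous_const

end MvPolynomial

section Irreducible

variable {n : ℕ} {M : Set (ℙ ℂ (Fin n → ℂ))}

/-- The points of projective space at which a homogeneous ideal vanishes form a closed set. -/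
theorem isClosed_projective_zeroLocus (J : Ideal (MvPolynomial (Fin n) ℂ))
    (hJ : ContainsComponents J) :
    IsClosed {y : ℙ ℂ (Fin n → ℂ) | ∃ (z : Fin n → ℂ) (hz : z ≠ 0),
      z ∈ zeroLocus ℂ J ∧ y = Projectivization.mk ℂ z hz} := by
  have hq : Topology.IsQuotientMap (fun z : {z : Fin n → ℂ // z ≠ 0} =>
    Projectivization.mk ℂ z.1 z.2) := isQuotientMap_quot_mk
  rw [← hq.isClosed_preimage]
  have : (fun z : {z : Fin n → ℂ // z ≠ 0} => Projectivization.mk ℂ z.1 z.2) ⁻¹'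
      {y : ℙ ℂ (Fin n → ℂ) | ∃ (z : Fin n → ℂ) (hz : z ≠ 0),
        z ∈ zeroLocus ℂ J ∧ y = Projectivization.mk ℂ z hz} =
      Subtype.val ⁻¹' zeroLocus ℂ J := by
    ext ⟨z, hz⟩
    constructor
    · rintro ⟨w, hw, hwJ, h⟩
      obtain ⟨a, ha⟩ := (Projectivization.mk_eq_mk_iff' ℂ z w hz hw).mp h
      change z ∈ zeroLocus ℂ J
      rw [← ha]
      exact smul_mem_zeroLocus hJ hwJ a
    · exact fun h => ⟨z, hz, h, rfl⟩
  rw [this]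
  exact (isClosed_zeroLocus J).preimage continuous_subtype_val

/-- A group of invertible matrices that acts transitively on a connected projective set up to
scalars forces the ideal of the set to be prime. -/
theorem isPrime_homogeneousIdeal (hM : IsConnected M)
    {K : Type*} [Group K] (ρ : K →* Matrix (Fin n) (Fin n) ℂ)
    (hρM : ∀ h, ∀ z ∈ puncturedCone M, (ρ h).mulVec z ∈ puncturedCone M)
    (htrans : ∀ z ∈ puncturedCone M, ∀ w ∈ puncturedCone M,
      ∃ (h : K) (c : ℂ), w = c • (ρ h).mulVec z) :
    (homogeneousIdeal M).IsPrime := by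
  set I := homogeneousIdeal M with hI
  have hIc : ContainsComponents I := containsComponents_homogeneousIdeal M
  have hinv : ∀ h, ρ h * ρ h⁻¹ = 1 := fun h => by rw [← map_mul, mul_inv_cancel, map_one]
  have hinv' : ∀ h, ρ h⁻¹ * ρ h = 1 := fun h => by rw [← map_mul, inv_mul_cancel, map_one]
  have hfin : I.minimalPrimes.Finite := Ideal.finite_minimalPrimes_of_isNoetherianRing _ I
  have hIt : ∀ h, I ≤ idealTranslate (ρ h) I := fun h f hf => by
    rw [mem_idealTranslate, hI, mem_homogeneousIdeal]
    intro z hz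
    rw [eval_linearSubst]
    exact (mem_homogeneousIdeal M).mp hf _ (hρM h z hz)
  have hmin : ∀ h, ∀ p ∈ I.minimalPrimes, idealTranslate (ρ h) p ∈ I.minimalPrimes := by
    intro h p hp
    have hprime : p.IsPrime := hp.1.1
    refine ⟨⟨Ideal.comap_isPrime _ p, (hIt h).trans (idealTranslate_mono _ hp.1.2)⟩, ?_⟩
    rintro q ⟨hq, hIq⟩ hqp
    have h1 : idealTranslate (ρ h⁻¹) q ≤ p := by
      have := idealTranslate_mono (ρ h⁻¹) hqp
      rwa [idealTranslate_idealTranslate, hinv', idealTranslate_one] at this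
    have h2 := hp.2 ⟨Ideal.comap_isPrime _ q, (hIt h⁻¹).trans (idealTranslate_mono _ hIq)⟩ h1
    have h3 := idealTranslate_mono (ρ h) h2
    change idealTranslate (ρ h) p ≤ idealTranslate (ρ h) (idealTranslate (ρ h⁻¹) q) at h3
    rwa [idealTranslate_idealTranslate, hinv, idealTranslate_one] at h3
  have hcover : ∀ z ∈ puncturedCone M, ∃ p ∈ I.minimalPrimes, z ∈ zeroLocus ℂ p := by
    intro z hz
    have hmax : (vanishingIdeal ℂ {z}).IsMaximal :=
      isMaximal_iff_eq_vanishingIdeal_singleton.mpr ⟨z, rfl⟩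
    have hle : I ≤ vanishingIdeal ℂ {z} := fun f hf => by
      rw [mem_vanishingIdeal_singleton_iff, aeval_self_apply]
      exact (mem_homogeneousIdeal M).mp hf z hz
    have hprime := hmax.isPrime
    obtain ⟨p, hp, hpz⟩ := Ideal.exists_minimalPrimes_le hle
    exact ⟨p, hp, fun f hf => (mem_vanishingIdeal_singleton_iff z f).mp (hpz hf)⟩
  -- Otherwise the product of the other minimal primes vanishes on the cone and lies in `I ≤ p`, so
  -- one of them lies in `p`, against minimality.
  have hsep : ∀ p ∈ I.minimalPrimes, ∃ z ∈ puncturedCone M, z ∈ zeroLocus ℂ p ∧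
      ∀ q ∈ I.minimalPrimes, z ∈ zeroLocus ℂ q → q = p := by
    intro p hp
    have hprime : p.IsPrime := hp.1.1
    suffices H : ∃ z ∈ puncturedCone M, ∀ q ∈ I.minimalPrimes, z ∈ zeroLocus ℂ q → q = p by
      obtain ⟨z, hz, hzq⟩ := H
      obtain ⟨r, hr, hzr⟩ := hcover z hz
      exact ⟨z, hz, hzq r hr hzr ▸ hzr, hzq⟩
    by_contra! hcon
    have hprod : ∏ q ∈ hfin.toFinset.erase p, q ≤ p := by
      refine le_trans (fun f hf => ?_) hp.1.2
      rw [hI, mem_homogeneousIdeal]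
      intro z hz
      obtain ⟨q, hq, hzq, hqp⟩ := hcon z hz
      have hmem : q ∈ hfin.toFinset.erase p :=
        Finset.mem_erase.mpr ⟨hqp, hfin.mem_toFinset.mpr hq⟩
      rw [← aeval_self_apply]
      exact hzq f (Ideal.prod_le_inf.trans (Finset.inf_le hmem) hf)
    obtain ⟨q, hq, hqp⟩ := hprime.prod_le.mp hprod
    rw [Finset.mem_erase, hfin.mem_toFinset] at hq
    exact hq.1 (le_antisymm hqp (hp.2 hq.2.1 hqp))
  -- The group permutes the components, and transitivity moves any point to one that lies on a
  -- single component.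
  have hdisj : ∀ p ∈ I.minimalPrimes, ∀ q ∈ I.minimalPrimes, ∀ z ∈ puncturedCone M,
      z ∈ zeroLocus ℂ p → z ∈ zeroLocus ℂ q → p = q := by
    intro p hp q hq z hz hzp hzq
    obtain ⟨w, hw, -, hwq⟩ := hsep p hp
    obtain ⟨h, c, rfl⟩ := htrans z hz w hw
    have key : ∀ r ∈ I.minimalPrimes, z ∈ zeroLocus ℂ r → idealTranslate (ρ h) r = p := by
      intro r hr hzr
      refine hwq _ (hmin h r hr) (smul_mem_zeroLocus
        (containsComponents_of_mem_minimalPrimes hIc (hmin h r hr)) ?_ c)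
      exact (mulVec_mem_zeroLocus_idealTranslate (hinv' h)).mpr hzr
    have h1 := (key p hp hzp).trans (key q hq hzq).symm
    have h2 := congrArg (idealTranslate (ρ h⁻¹)) h1
    rwa [idealTranslate_idealTranslate, idealTranslate_idealTranslate, hinv',
      idealTranslate_one, idealTranslate_one] at h2
  obtain ⟨y₀, hy₀⟩ := hM.nonempty
  obtain ⟨z₀, hz₀, rfl⟩ := y₀.ind (P := fun y => ∃ (z : Fin n → ℂ) (hz : z ≠ 0),
    y = Projectivization.mk ℂ z hz) (fun z hz => ⟨z, hz, rfl⟩)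
  obtain ⟨p, hp, -⟩ := hcover z₀ ⟨hz₀, hy₀⟩
  -- The components cut the connected set `M` into finitely many disjoint non-empty closed pieces.
  have huniq : ∀ q ∈ I.minimalPrimes, q = p := by
    intro q hq
    by_contra hqp
    let Z : Ideal (MvPolynomial (Fin n) ℂ) → Set (ℙ ℂ (Fin n → ℂ)) := fun J =>
      {y | ∃ (z : Fin n → ℂ) (hz : z ≠ 0), z ∈ zeroLocus ℂ J ∧ y = Projectivization.mk ℂ z hz}
    have hZ : ∀ r ∈ I.minimalPrimes, IsClosed (Z r) := fun r hr =>
      isClosed_projective_zeroLocus r (containsComponents_of_mem_minimalPrimes hIc hr)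
    have hZmem : ∀ r ∈ I.minimalPrimes, ∀ z (hz : z ≠ 0), Projectivization.mk ℂ z hz ∈ Z r →
        z ∈ zeroLocus ℂ r := by
      rintro r hr z hz ⟨w, hw, hwr, h⟩
      obtain ⟨a, ha⟩ := (Projectivization.mk_eq_mk_iff' ℂ z w hz hw).mp h
      rw [← ha]
      exact smul_mem_zeroLocus (containsComponents_of_mem_minimalPrimes hIc hr) hwr a
    obtain ⟨y, hyM, hy1, hy2⟩ := isPreconnected_closed_iff.mp hM.isPreconnected (Z p)
      (⋃ r ∈ I.minimalPrimes \ {p}, Z r) (hZ p hp)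
      ((hfin.subset Set.sdiff_subset).isClosed_biUnion fun r hr => hZ r hr.1)
      (by
        intro y hy
        induction y using Projectivization.ind with
        | h z hz =>
          obtain ⟨r, hr, hzr⟩ := hcover z ⟨hz, hy⟩
          by_cases hrp : r = p
          · exact Or.inl ⟨z, hz, hrp ▸ hzr, rfl⟩
          · exact Or.inr (Set.mem_biUnion (⟨hr, hrp⟩ : r ∈ I.minimalPrimes \ {p})
              ⟨z, hz, hzr, rfl⟩))
      (by
        obtain ⟨z, ⟨hz, hzM⟩, hzp, -⟩ := hsep p hp
        exact ⟨_, hzM, z, hz, hzp, rfl⟩)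
      (by
        obtain ⟨z, ⟨hz, hzM⟩, hzq, -⟩ := hsep q hq
        exact ⟨_, hzM, Set.mem_biUnion (⟨hq, hqp⟩ : q ∈ I.minimalPrimes \ {p})
          ⟨z, hz, hzq, rfl⟩⟩)
    induction y using Projectivization.ind with
    | h z hz =>
      obtain ⟨r, hr, hyr⟩ := Set.mem_iUnion₂.mp hy2
      exact hr.2 (hdisj r hr.1 p hp z ⟨hz, hyM⟩ (hZmem r hr.1 z hz hyr) (hZmem p hp z hz hy1))
  have hrad : I = p := by
    have h1 : I.minimalPrimes = {p} := Set.eq_singleton_iff_unique_mem.mpr ⟨hp, huniq⟩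
    have h2 := I.sInf_minimalPrimes
    rw [h1, sInf_singleton] at h2
    rw [h2]
    refine le_antisymm Ideal.le_radical fun f hf => ?_
    obtain ⟨m, hm⟩ := hf
    rw [hI, mem_homogeneousIdeal] at hm ⊢
    intro z hz
    have := hm z hz
    rw [map_pow] at this
    exact eq_zero_of_pow_eq_zero this
  rw [hrad]
  exact hp.1.1

end Irreducible

/-! ### Averaging over a compact group -/

section Averaging

/-- The averaged kernels are sesquiholomorphic polynomials. -/
theorem exists_eval_eq_integral {n : ℕ} {K : Type*} [TopologicalSpace K] [CompactSpace K]
    [MeasurableSpace K] [BorelSpace K] (μ : Measure K) [IsProbabilityMeasure μ]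
    {u : K → Fin n → ℂ} (hu : Continuous u) (k : ℕ) :
    ∃ F : MvPolynomial (Fin n ⊕ Fin n) ℂ, ∀ z w : Fin n → ℂ, eval (Sum.elim z (star w)) F =
      ∫ x, (u x ⬝ᵥ star w) ^ k * (z ⬝ᵥ star (u x)) ^ k ∂μ := by
  let a : (Fin k → Fin n) → (Fin k → Fin n) → ℂ := fun p q =>
    ∫ x, (∏ i, u x (p i)) * ∏ i, star (u x (q i)) ∂μ
  refine ⟨∑ p : Fin k → Fin n, ∑ q : Fin k → Fin n,
    C (a p q) * ((∏ i, X (Sum.inr (p i))) * ∏ i, X (Sum.inl (q i))), fun z w => ?_⟩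
  have hui : ∀ i, Continuous fun x => u x i := fun i => (continuous_apply i).comp hu
  have hint : ∀ p q : Fin k → Fin n, Integrable (fun x =>
      ((∏ i, star w (p i)) * ∏ i, z (q i)) *
        ((∏ i, u x (p i)) * ∏ i, star (u x (q i)))) μ := fun p q =>
    (Continuous.integrable_of_hasCompactSupport
      ((continuous_finsetProd _ fun i _ => hui (p i)).mul
        (continuous_finsetProd _ fun i _ => (hui (q i)).star))
      (HasCompactSupport.of_compactSpace _)).const_mul _
  have hexp : ∀ x, (u x ⬝ᵥ star w) ^ k * (z ⬝ᵥ star (u x)) ^ k =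
      ∑ p : Fin k → Fin n, ∑ q : Fin k → Fin n, ((∏ i, star w (p i)) * ∏ i, z (q i)) *
        ((∏ i, u x (p i)) * ∏ i, star (u x (q i))) := by
    intro x
    rw [dotProduct, dotProduct, Fintype.sum_pow, Fintype.sum_pow, Finset.sum_mul_sum]
    refine Finset.sum_congr rfl fun p _ => Finset.sum_congr rfl fun q _ => ?_
    rw [Finset.prod_mul_distrib, Finset.prod_mul_distrib]
    simp only [Pi.star_apply]
    ring
  simp only [hexp]
  rw [integral_finsetSum _ fun p _ => integrable_finsetSum _ fun q _ => hint p q, map_sum]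
  refine Finset.sum_congr rfl fun p _ => ?_
  rw [integral_finsetSum _ fun q _ => hint p q, map_sum]
  refine Finset.sum_congr rfl fun q _ => ?_
  rw [integral_const_mul]
  simp only [map_mul, map_prod, eval_C, eval_X, Sum.elim_inl, Sum.elim_inr, a]
  ring

variable {n : ℕ} {K : Type*} [Group K] [TopologicalSpace K] [IsTopologicalGroup K]
  [MeasurableSpace K] [BorelSpace K] (μ : Measure K) [IsProbabilityMeasure μ]
  [μ.IsMulLeftInvariant]

/-- If the zero set had positive measure, take `J` maximal among the ideals containing `f₀` with
non-null zero set `W J` in the group. By maximality, distinct translates of `J` have zero sets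
meeting in null sets; all have equal measure, so there are finitely many translates. Their product
vanishes along the orbit and lies in the prime `I`, so some translate lies in `I`. As `I` is stable
under the group, `f₀ ∈ J ≤ I`. -/
theorem ae_eval_mulVec_ne_zero (ρ : K →* Matrix (Fin n) (Fin n) ℂ) (hρ : Continuous ρ)
    (v : Fin n → ℂ) (I : Ideal (MvPolynomial (Fin n) ℂ)) (hI : I.IsPrime)
    (hIv : ∀ f, (∀ x, eval ((ρ x).mulVec v) f = 0) ↔ f ∈ I)
    (f₀ : MvPolynomial (Fin n) ℂ) (hf₀ : f₀ ∉ I) : ∀ᵐ x ∂μ, eval ((ρ x).mulVec v) f₀ ≠ 0 := by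
  classical
  have hinv' : ∀ h, ρ h⁻¹ * ρ h = 1 := fun h => by rw [← map_mul, inv_mul_cancel, map_one]
  have hinv : ∀ h, ρ h * ρ h⁻¹ = 1 := fun h => by rw [← map_mul, mul_inv_cancel, map_one]
  let W : Ideal (MvPolynomial (Fin n) ℂ) → Set K := fun J => {x | (ρ x).mulVec v ∈ zeroLocus ℂ J}
  have hWmem : ∀ J x, x ∈ W J ↔ ∀ f ∈ J, eval ((ρ x).mulVec v) f = 0 := fun J x => by
    simp only [W, Set.mem_ofPred_eq, mem_zeroLocus_iff, aeval_self_apply]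
  have hWmeas : ∀ J, MeasurableSet (W J) := fun J =>
    ((isClosed_zeroLocus J).preimage (hρ.matrix_mulVec continuous_const)).measurableSet
  have hWtr : ∀ h J, W (idealTranslate (ρ h) J) = (fun x => h⁻¹ * x) ⁻¹' W J := by
    intro h J
    ext x
    have : (ρ x).mulVec v = (ρ h).mulVec ((ρ (h⁻¹ * x)).mulVec v) := by
      rw [Matrix.mulVec_mulVec, ← map_mul, mul_inv_cancel_left]
    simp only [W, Set.mem_ofPred_eq, Set.mem_preimage]
    rw [this, mulVec_mem_zeroLocus_idealTranslate (hinv' h)]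
  have hWμ : ∀ h J, μ (W (idealTranslate (ρ h) J)) = μ (W J) := fun h J => by
    rw [hWtr, measure_preimage_mul]
  have hWsup : ∀ J J', W J ∩ W J' ⊆ W (J ⊔ J') := by
    intro J J' x hx
    rw [hWmem]
    intro f hf
    obtain ⟨a, ha, b, hb, rfl⟩ := Submodule.mem_sup.mp hf
    rw [map_add, (hWmem J x).mp hx.1 a ha, (hWmem J' x).mp hx.2 b hb, add_zero]
  by_contra hcon
  have h0 : μ (W (Ideal.span {f₀})) ≠ 0 := by
    intro h
    refine hcon (measure_mono_null (fun x hx => ?_) h)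
    rw [hWmem]
    intro f hf
    obtain ⟨a, rfl⟩ := Ideal.mem_span_singleton'.mp hf
    have hx' : eval ((ρ x).mulVec v) f₀ = 0 := by simpa using hx
    rw [map_mul, hx', mul_zero]
  obtain ⟨J, ⟨hJ₀, hJμ⟩, hJmax⟩ := set_has_maximal_iff_noetherian.mpr
    (inferInstance : IsNoetherian (MvPolynomial (Fin n) ℂ) (MvPolynomial (Fin n) ℂ))
    {J | Ideal.span {f₀} ≤ J ∧ μ (W J) ≠ 0} ⟨_, le_rfl, h0⟩
  have hmax : ∀ h J', idealTranslate (ρ h) J ≤ J' → μ (W J') ≠ 0 →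
      J' = idealTranslate (ρ h) J := by
    intro h J' hle hμ
    have h1 : J ≤ idealTranslate (ρ h⁻¹) J' := by
      have := idealTranslate_mono (ρ h⁻¹) hle
      rwa [idealTranslate_idealTranslate, hinv', idealTranslate_one] at this
    have h2 : J = idealTranslate (ρ h⁻¹) J' := by
      by_contra hne
      exact hJmax _ ⟨hJ₀.trans h1, by rwa [hWμ]⟩ (lt_of_le_of_ne h1 hne)
    rw [h2, idealTranslate_idealTranslate, hinv, idealTranslate_one]
  let R : Set (Ideal (MvPolynomial (Fin n) ℂ)) := Set.range fun h => idealTranslate (ρ h) J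
  have hRfin : R.Finite := by
    have h := Measure.finite_const_le_meas_of_disjoint_iUnion₀ μ (ε := μ (W J))
      (pos_iff_ne_zero.mpr hJμ) (As := fun r : R => W r.1)
      (fun r => (hWmeas _).nullMeasurableSet) (by
        rintro ⟨_, h, rfl⟩ ⟨_, h', rfl⟩ hne
        by_contra hd
        have hμ : μ (W (idealTranslate (ρ h) J ⊔ idealTranslate (ρ h') J)) ≠ 0 := fun hz =>
          hd (measure_mono_null (hWsup _ _) hz)
        exact hne (Subtype.ext ((hmax h _ le_sup_left hμ).symm.trans
          (hmax h' _ le_sup_right hμ)))) (measure_ne_top _ _)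
    have huniv : {r : R | μ (W J) ≤ μ (W r.1)} = Set.univ := by
      refine Set.eq_univ_of_forall ?_
      rintro ⟨_, h, rfl⟩
      exact (hWμ h J).ge
    rw [huniv, Set.finite_univ_iff] at h
    exact Set.toFinite R
  obtain ⟨x₀, hx₀⟩ := nonempty_of_measure_ne_zero hJμ
  have hprod : ∏ r ∈ hRfin.toFinset, r ≤ I := by
    intro f hf
    rw [← hIv]
    intro x
    -- Left translation by `x * x₀⁻¹` carries `x₀ ∈ W J` to `x`.
    have hx : x ∈ W (idealTranslate (ρ (x * x₀⁻¹)) J) := by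
      rw [hWtr]
      simpa using hx₀
    refine (hWmem _ _).mp hx f ((Ideal.prod_le_inf (f := fun r => r)).trans (Finset.inf_le ?_) hf)
    exact hRfin.mem_toFinset.mpr ⟨_, rfl⟩
  obtain ⟨r, hr, hrI⟩ := hI.prod_le.mp hprod
  rw [hRfin.mem_toFinset] at hr
  obtain ⟨h, rfl⟩ := hr
  have hJI : J ≤ I := by
    intro f hf
    rw [← hIv]
    intro x
    have h1 : linearSubst (ρ h⁻¹) f ∈ I := hrI (by
      rw [mem_idealTranslate, linearSubst_linearSubst, hinv', linearSubst_one]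
      exact hf)
    rw [← hIv] at h1
    have h2 := h1 (h * x)
    rwa [eval_linearSubst, Matrix.mulVec_mulVec, ← map_mul, inv_mul_cancel_left] at h2
  exact hf₀ (hJI (hJ₀ (Ideal.mem_span_singleton_self f₀)))

variable [CompactSpace K]

/-- Both sides are polynomials in `z` and `star w`. On the diagonal, `z = b • ρ h v` reduces to `v`
by unitarity and left invariance of `μ`; polarization does the rest. -/
theorem integral_kernel_eq (ρ : K →* Matrix (Fin n) (Fin n) ℂ) (hρ : Continuous ρ)
    (hunit : ∀ h z w, (ρ h).mulVec z ⬝ᵥ star ((ρ h).mulVec w) = z ⬝ᵥ star w)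
    {v : Fin n → ℂ} (hv1 : v ⬝ᵥ star v = 1) (I : Ideal (MvPolynomial (Fin n) ℂ)) [I.IsPrime]
    (hI : ∀ z ∈ zeroLocus ℂ I, ∃ (h : K) (c : ℂ), z = c • (ρ h).mulVec v) (k : ℕ) :
    ∀ z ∈ zeroLocus ℂ I, ∀ w ∈ zeroLocus ℂ I,
      ∫ x, ((ρ x).mulVec v ⬝ᵥ star w) ^ k * (z ⬝ᵥ star ((ρ x).mulVec v)) ^ k ∂μ =
        (∫ x, ((ρ x).mulVec v ⬝ᵥ star v) ^ k * (v ⬝ᵥ star ((ρ x).mulVec v)) ^ k ∂μ) *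
          (z ⬝ᵥ star w) ^ k := by
  have hu : Continuous fun x => (ρ x).mulVec v := hρ.matrix_mulVec continuous_const
  obtain ⟨F, hF⟩ := exists_eval_eq_integral μ hu k
  set c := ∫ x, ((ρ x).mulVec v ⬝ᵥ star v) ^ k * (v ⬝ᵥ star ((ρ x).mulVec v)) ^ k ∂μ with hc
  have hG : ∀ z w : Fin n → ℂ, eval (Sum.elim z (star w))
      (F - C c * (∑ i, X (Sum.inl i) * X (Sum.inr i)) ^ k) =
      (∫ x, ((ρ x).mulVec v ⬝ᵥ star w) ^ k * (z ⬝ᵥ star ((ρ x).mulVec v)) ^ k ∂μ) -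
        c * (z ⬝ᵥ star w) ^ k := fun z w => by
    rw [map_sub, hF]
    simp [dotProduct]
  have hpol := eval_elim_star_eq_zero I (F - C c * (∑ i, X (Sum.inl i) * X (Sum.inr i)) ^ k) (by
    intro z hz
    rw [hG]
    obtain ⟨h, b, rfl⟩ := hI z hz
    have hx : ∀ x, ((ρ x).mulVec v ⬝ᵥ star (b • (ρ h).mulVec v)) ^ k *
        ((b • (ρ h).mulVec v) ⬝ᵥ star ((ρ x).mulVec v)) ^ k =
        (star b * b) ^ k * ((fun y => ((ρ y).mulVec v ⬝ᵥ star v) ^ k *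
          (v ⬝ᵥ star ((ρ y).mulVec v)) ^ k) (h⁻¹ * x)) := by
      intro x
      have h1 : (ρ x).mulVec v = (ρ h).mulVec ((ρ (h⁻¹ * x)).mulVec v) := by
        rw [Matrix.mulVec_mulVec, ← map_mul, mul_inv_cancel_left]
      rw [h1, star_smul, dotProduct_smul, smul_dotProduct, hunit, hunit, smul_eq_mul, smul_eq_mul,
        mul_pow, mul_pow, mul_pow]
      ring
    simp only [hx]
    rw [integral_const_mul, integral_mul_left_eq_self (μ := μ) (fun y =>
      ((ρ y).mulVec v ⬝ᵥ star v) ^ k * (v ⬝ᵥ star ((ρ y).mulVec v)) ^ k) h⁻¹, ← hc,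
      star_smul, dotProduct_smul, smul_dotProduct, hunit, hv1, smul_eq_mul, smul_eq_mul, mul_one]
    ring)
  intro z hz w hw
  have := hpol z hz w hw
  rwa [hG, sub_eq_zero] at this

end Averaging

/-- The compressed shift of a connected projective variety on which a compact group of unitary
matrices containing the scalars acts transitively. -/
theorem isQIsometry_of_transitive_action {n d : ℕ} {M : Set (ℙ ℂ (Fin n → ℂ))}
    (hconn : IsConnected M) (hvar : IsProjectiveVariety M) (hd : HasComplexDim M d)
    {K : Type*} [Group K] [TopologicalSpace K] [IsTopologicalGroup K] [CompactSpace K]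
    (ρ : K →* Matrix (Fin n) (Fin n) ℂ) (hρ : Continuous ρ)
    (hunit : ∀ h z w, (ρ h).mulVec z ⬝ᵥ star ((ρ h).mulVec w) = z ⬝ᵥ star w)
    (hscal : ∀ c : Circle, ∃ h, ρ h = (c : ℂ) • (1 : Matrix (Fin n) (Fin n) ℂ))
    {v : Fin n → ℂ} (hv1 : v ⬝ᵥ star v = 1) (hv : ∀ h, (ρ h).mulVec v ∈ puncturedCone M)
    (htrans : ∀ z ∈ puncturedCone M, ∃ (h : K) (c : ℂ), z = c • (ρ h).mulVec v) :
    IsQIsometry (d + 1) (fun α : Fin n => compressedShift M α) := by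
  let _ : MeasurableSpace K := borel K
  have : BorelSpace K := ⟨rfl⟩
  let μ : Measure K := Measure.haarMeasure ⊤
  have hμ : IsProbabilityMeasure μ := ⟨Measure.haarMeasure_self⟩
  have hne : ∀ {z : Fin n → ℂ}, z ∈ puncturedCone M → z ≠ 0 := fun hz => hz.1
  have hρM : ∀ h, ∀ z ∈ puncturedCone M, (ρ h).mulVec z ∈ puncturedCone M := by
    intro h z hz
    obtain ⟨g, c, rfl⟩ := htrans z hz
    rw [Matrix.mulVec_smul, Matrix.mulVec_mulVec, ← map_mul]
    refine smul_mem_puncturedCone (hv _) ?_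
    rintro rfl
    exact hne hz (zero_smul _ _)
  have hI : (homogeneousIdeal M).IsPrime := by
    refine isPrime_homogeneousIdeal hconn ρ hρM fun z hz w hw => ?_
    obtain ⟨g, a, rfl⟩ := htrans z hz
    obtain ⟨h, b, rfl⟩ := htrans w hw
    have ha : a ≠ 0 := by
      rintro rfl
      exact hne hz (zero_smul _ _)
    refine ⟨h * g⁻¹, b * a⁻¹, ?_⟩
    rw [Matrix.mulVec_smul, Matrix.mulVec_mulVec, ← map_mul, inv_mul_cancel_right, smul_smul,
      inv_mul_cancel_right₀ ha]
  have hv0 : v ∈ puncturedCone M := by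
    have := hv 1
    rwa [map_one, Matrix.one_mulVec] at this
  have hcone : ∀ z ∈ puncturedCone M, z ∈ zeroLocus ℂ (homogeneousIdeal M) := fun z hz f hf => by
    rw [aeval_self_apply]
    exact (mem_homogeneousIdeal M).mp hf z hz
  -- The zero locus adds only the origin to the cone, since `M` is Zariski closed; the origin is
  -- reached with the scalar `0`.
  have hE := integral_kernel_eq μ ρ hρ hunit hv1 (homogeneousIdeal M) (fun z hz => by
    by_cases hz0 : z = 0
    · exact ⟨1, 0, by rw [hz0, zero_smul]⟩
    · exact htrans z ⟨hz0, hvar z hz0 hz⟩)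
  -- The scalars in the group serve here: a polynomial vanishing along the orbit of `v` vanishes at
  -- infinitely many multiples of each point, so its homogeneous components vanish separately.
  have hIv : ∀ f, (∀ x, eval ((ρ x).mulVec v) f = 0) ↔ f ∈ homogeneousIdeal M := by
    intro f
    refine ⟨fun hf => ?_, fun hf x => (mem_homogeneousIdeal M).mp hf _ (hv x)⟩
    rw [mem_homogeneousIdeal]
    intro z hz
    obtain ⟨h, c, rfl⟩ := htrans z hz
    rw [eval_smul_eq_sum]
    refine Finset.sum_eq_zero fun k _ => ?_
    rw [eval_homogeneousComponent_eq_zero (S := Set.range ((↑) : Circle → ℂ))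
      (by
        have : Infinite (Set.Ioc (-Real.pi) Real.pi) :=
          (Set.Ioc_infinite (by linarith [Real.pi_pos])).to_subtype
        have : Infinite Circle := Circle.argEquiv.infinite_iff.mpr this
        exact @Set.infinite_range_of_injective Circle ℂ this _ Circle.coe_injective), mul_zero]
    rintro _ ⟨a, rfl⟩
    obtain ⟨g, hg⟩ := hscal a
    have := hf (g * h)
    rwa [map_mul, ← Matrix.mulVec_mulVec, hg, Matrix.smul_mulVec, Matrix.one_mulVec] at this
  have hnull := ae_eval_mulVec_ne_zero μ ρ hρ v (homogeneousIdeal M) hI hIv (kernelPoly 1 v)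
    (fun h => by
      have := (mem_homogeneousIdeal M).mp h v hv0
      rw [eval_kernelPoly, hv1, one_pow] at this
      exact one_ne_zero this)
  refine isQIsometry_of_integral_kernel μ hd (hρ.matrix_mulVec continuous_const) hv
    (fun x => (hunit x v v).trans hv1) hv0 hv1
    (fun k z hz w hw => hE k z (hcone z hz) w (hcone w hw)) ?_
  filter_upwards [hnull] with x hx
  rwa [eval_kernelPoly, pow_one] at hx

/-! ### Orbits of closed groups of unitary matrices -/

section UnitaryOrbits

variable {n : ℕ}

instance unitaryGroup_compactSpace : CompactSpace (Matrix.unitaryGroup (Fin n) ℂ) := by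
  refine (isCompact_iff_compactSpace
    (s := (Matrix.unitaryGroup (Fin n) ℂ : Set (Matrix (Fin n) (Fin n) ℂ)))).mp ?_
  have hclosed : IsClosed (Matrix.unitaryGroup (Fin n) ℂ : Set (Matrix (Fin n) (Fin n) ℂ)) := by
    have : (Matrix.unitaryGroup (Fin n) ℂ : Set (Matrix (Fin n) (Fin n) ℂ)) =
        {A | A * star A = 1} := by
      ext A
      exact Matrix.mem_unitaryGroup_iff
    rw [this]
    exact isClosed_eq (continuous_id.mul continuous_star) continuous_const
  refine IsCompact.of_isClosed_subset (isCompact_univ_pi fun _ : Fin n =>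
    isCompact_univ_pi fun _ : Fin n => isCompact_closedBall (0 : ℂ) 1) hclosed
    fun A hA i _ j _ => ?_
  rw [mem_closedBall_zero_iff]
  exact entry_norm_bound_of_unitary hA i j

/-- A group of unitary matrices together with the scalars of modulus one. -/
def circleAction (G : Subgroup (Matrix.unitaryGroup (Fin n) ℂ)) :
    Circle × G →* Matrix (Fin n) (Fin n) ℂ where
  toFun x := (x.1 : ℂ) • ((x.2 : Matrix.unitaryGroup (Fin n) ℂ) : Matrix (Fin n) (Fin n) ℂ)
  map_one' := by simp
  map_mul' x y := by simp [smul_smul, mul_comm]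

theorem circleAction_apply (G : Subgroup (Matrix.unitaryGroup (Fin n) ℂ)) (x : Circle × G) :
    circleAction G x =
      (x.1 : ℂ) • ((x.2 : Matrix.unitaryGroup (Fin n) ℂ) : Matrix (Fin n) (Fin n) ℂ) := rfl

theorem continuous_circleAction (G : Subgroup (Matrix.unitaryGroup (Fin n) ℂ)) :
    Continuous (circleAction G) :=
  (continuous_subtype_val.comp continuous_fst).smul
    (continuous_subtype_val.comp (continuous_subtype_val.comp continuous_snd))

theorem mulVec_dotProduct_star_mulVec (g : Matrix.unitaryGroup (Fin n) ℂ) (z w : Fin n → ℂ) :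
    (g : Matrix (Fin n) (Fin n) ℂ).mulVec z ⬝ᵥ star ((g : Matrix (Fin n) (Fin n) ℂ).mulVec w) =
      z ⬝ᵥ star w := by
  have h : star (g : Matrix (Fin n) (Fin n) ℂ) * (g : Matrix (Fin n) (Fin n) ℂ) = 1 :=
    Matrix.mem_unitaryGroup_iff'.mp g.2
  rw [Matrix.star_mulVec, dotProduct_comm, ← Matrix.dotProduct_mulVec, Matrix.mulVec_mulVec,
    ← Matrix.star_eq_conjTranspose, h, Matrix.one_mulVec, dotProduct_comm]

open scoped ComplexOrder in
theorem mulVec_ne_zero_of_unitary (g : Matrix.unitaryGroup (Fin n) ℂ) {v : Fin n → ℂ}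
    (hv : v ≠ 0) : (g : Matrix (Fin n) (Fin n) ℂ).mulVec v ≠ 0 := by
  intro h
  have h1 := mulVec_dotProduct_star_mulVec g v v
  rw [h, zero_dotProduct] at h1
  exact hv (dotProduct_self_star_eq_zero.mp h1.symm)

open scoped ComplexOrder in
theorem exists_unit_representative (x : ℙ ℂ (Fin n → ℂ)) :
    ∃ (v : Fin n → ℂ) (hv : v ≠ 0), v ⬝ᵥ star v = 1 ∧ x = Projectivization.mk ℂ v hv := by
  induction x using Projectivization.ind with
  | h w hw =>
    have hsum : w ⬝ᵥ star w = ((∑ i, ‖w i‖ ^ 2 : ℝ) : ℂ) := by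
      simp [dotProduct, Complex.mul_conj, Complex.normSq_eq_norm_sq]
    set r : ℝ := ∑ i, ‖w i‖ ^ 2 with hr
    have hr0 : r ≠ 0 := by
      intro h
      rw [h, Complex.ofReal_zero] at hsum
      exact hw (dotProduct_self_star_eq_zero.mp hsum)
    have hrpos : 0 < r := lt_of_le_of_ne (Finset.sum_nonneg fun i _ => by positivity) hr0.symm
    have hs0 : ((Real.sqrt r)⁻¹ : ℂ) ≠ 0 := by
      have := (Real.sqrt_pos.mpr hrpos).ne'
      exact_mod_cast inv_ne_zero this
    refine ⟨((Real.sqrt r)⁻¹ : ℂ) • w, smul_ne_zero hs0 hw, ?_, ?_⟩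
    · have h1 : star ((Real.sqrt r)⁻¹ : ℂ) = ((Real.sqrt r)⁻¹ : ℂ) := by
        rw [← Complex.ofReal_inv]
        exact Complex.conj_ofReal _
      rw [star_smul, dotProduct_smul, smul_dotProduct, hsum, h1, smul_eq_mul, smul_eq_mul]
      have h2 : (Real.sqrt r)⁻¹ * ((Real.sqrt r)⁻¹ * r) = 1 := by
        rw [← mul_assoc, ← mul_inv, Real.mul_self_sqrt hrpos.le, inv_mul_cancel₀ hr0]
      exact_mod_cast congrArg (fun t : ℝ => (t : ℂ)) h2
    · rw [eq_comm, Projectivization.mk_eq_mk_iff']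
      exact ⟨_, rfl⟩

theorem mem_puncturedCone_projectiveOrbit (G : Subgroup (Matrix.unitaryGroup (Fin n) ℂ))
    {v : Fin n → ℂ} (hv : v ≠ 0) {z : Fin n → ℂ} :
    z ∈ puncturedCone (projectiveOrbit G (Projectivization.mk ℂ v hv)) ↔
      ∃ g ∈ G, ∃ c : ℂ, c ≠ 0 ∧ z = c • (g : Matrix (Fin n) (Fin n) ℂ).mulVec v := by
  constructor
  · rintro ⟨hz, g, hg, v', w', hv', hw', rfl, h1, h2⟩
    obtain ⟨a, rfl⟩ := (Projectivization.mk_eq_mk_iff' ℂ _ _ hv' hv).mp h1.symm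
    obtain ⟨b, rfl⟩ := (Projectivization.mk_eq_mk_iff' ℂ _ _ hz hw').mp h2
    refine ⟨g, hg, b * a, fun h => hz ?_, ?_⟩
    · rw [Matrix.mulVec_smul, smul_smul, h, zero_smul]
    · rw [Matrix.mulVec_smul, smul_smul]
  · rintro ⟨g, hg, c, hc, rfl⟩
    have hgv := mulVec_ne_zero_of_unitary g hv
    refine ⟨smul_ne_zero hc hgv, g, hg, v, _, hv, hgv, rfl, rfl, ?_⟩
    rw [Projectivization.mk_eq_mk_iff']
    exact ⟨c, rfl⟩

end UnitaryOrbits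

/-- The compressed shift tuple on the graded quotient module of the Drury–Arveson space `H²_n`
associated with a coadjoint orbit `M ⊆ ℂℙ^{n-1}` of complex dimension `d` is a
`(d + 1)`-isometry. -/
theorem mainTheorem9 (n d : ℕ) (M : Set (ℙ ℂ (Fin n → ℂ))) (hM : IsCoadjointOrbit M)
    (hd : HasComplexDim M d) :
    IsQIsometry (d + 1) (fun α : Fin n => compressedShift M α) := by
  obtain ⟨G, hG, x, hx⟩ := hM.homogeneous
  obtain ⟨v, hv, hv1, rfl⟩ := exists_unit_representative x
  have : CompactSpace G := isCompact_iff_compactSpace.mp hG.isCompact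
  -- Adjoining the circle keeps the group compact and does not change its orbits in projective
  -- space.
  refine isQIsometry_of_transitive_action hM.connected hM.variety hd (circleAction G)
    (continuous_circleAction G) (fun h z w => ?_) (fun c => ⟨(c, 1), ?_⟩) hv1 (fun h => ?_)
    (fun z hz => ?_)
  · have hc : star (h.1 : ℂ) * (h.1 : ℂ) = 1 := by
      have := Circle.normSq_coe h.1
      rw [RCLike.star_def, mul_comm, Complex.mul_conj, this, Complex.ofReal_one]
    rw [circleAction_apply, Matrix.smul_mulVec, Matrix.smul_mulVec, star_smul, dotProduct_smul,
      smul_dotProduct, mulVec_dotProduct_star_mulVec, smul_smul, hc, one_smul]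
  · rw [circleAction_apply]
    rfl
  · rw [hx, mem_puncturedCone_projectiveOrbit]
    exact ⟨h.2, h.2.2, h.1, Circle.coe_ne_zero h.1, by rw [circleAction_apply, Matrix.smul_mulVec]⟩
  · rw [hx, mem_puncturedCone_projectiveOrbit] at hz
    obtain ⟨g, hg, c, -, rfl⟩ := hz
    refine ⟨(1, ⟨g, hg⟩), c, ?_⟩
    rw [circleAction_apply]
    simp
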